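/- Let $F$ be an algebraically closed field of characteristic zero. Algebras are associative, not necessarily with an identity element, and polynomials are elements of the free associative $F$-algebra without identity element $F\langle X\rangle$ on countably many noncommuting variables. For a finite-dimensional $F$-algebra $A$ let $J(A)$ be its Jacobson radical, $d(A)=\dim_F A/J(A)$ (the dimension of a semisimple subalgebra supplementing $J(A)$), let $n_A$ be the nilpotency index of $J(A)$ (the least $n\ge 1$ with $J(A)^n=0$), and put $\mathrm{Par}(A)=(d(A),n_A-1)$; such pairs are ordered lexicographically. The algebra $A$ is called basic if it is not PI equivalent to (that is, does not satisfy the same polynomial identities as) a product $B_1\times\cdots\times B_r$, $r\ge 1$, of finite-dimensional $F$-algebras with $\mathrm{Par}(B_i)<\mathrm{Par}(A)$ for all $i$. A multilinear polynomial $f$ is alternating on a set $\{x_1,\dots,x_k\}$ of variables (with further variables $Y$) if $f=\sum_{\sigma\in \mathrm{Sym}(k)}(-1)^{\sigma}h(x_{\sigma(1)},\dots,x_{\sigma(k)},Y)$ for some polynomial $h$ that is multilinear on $\{x_1,\dots,x_k\}$. **Lemma (Kemer's Lemma 2).** Let $A\neq 0$ be a basic finite-dimensional $F$-algebra, and let $\mathrm{Par}(A)=(d,n_A-1)$.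 Then for every integer $\nu\ge 0$ there is a multilinear polynomial $f\in F\langle X\rangle$ which is not an identity of $A$ and which is alternating on each of $\nu+(n_A-1)$ pairwise disjoint sets of variables, $\nu$ of them of cardinality $d$ (small sets) and precisely $n_A-1$ of them of cardinality $d+1$ (big sets); here precisely means that, moreover, no family of pairwise disjoint sets of $d+1$ variables, on each of which $f$ is alternating, has more than $n_A-1$ members. -/

import Mathlib

universe u v

namespace PIAlgebra

/-! ## The Jacobson radical, its nilpotency index, and the parameter of an algebra

Algebras are associative and need not have an identity element. -/

section Quasiregular

variable {A : Type v} [NonUnitalRing A]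

theorem isQuasiregular_circle {x y : A} (hx : IsQuasiregular x) (hy : IsQuasiregular y) :
    IsQuasiregular (y + x + x * y) := by
  obtain ⟨s, rfl⟩ := hx
  obtain ⟨t, rfl⟩ := hy
  exact ⟨s * t, rfl⟩

theorem isQuasiregular_add_mul {a b : A} (ha : ∀ x, IsQuasiregular (a * x))
    (hb : ∀ x, IsQuasiregular (b * x)) (x : A) : IsQuasiregular ((a + b) * x) := by
  obtain ⟨y, h1, -⟩ := isQuasiregular_iff.1 (ha x)
  have h3 : IsQuasiregular (b * x + y * (b * x)) := by
    obtain ⟨z, hz1, hz2⟩ := isQuasiregular_iff.1 (hb (x + x * y))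
    generalize hc : b * x = c at *
    have hd : b * (x + x * y) = c + c * y := by rw [← hc]; noncomm_ring
    rw [hd] at hz1 hz2
    refine isQuasiregular_iff.2 ⟨-(c + y * c + z * c + y * z * c), ?_, ?_⟩
    · have : -(c + y * c + z * c + y * z * c) + (c + y * c)
          + (c + y * c) * -(c + y * c + z * c + y * z * c)
          = -((z + (c + c * y) + (c + c * y) * z) * c)
            - y * (z + (c + c * y) + (c + c * y) * z) * c := by noncomm_ring
      rw [this, hz1]; simp
    · have : c + y * c + -(c + y * c + z * c + y * z * c)
          + -(c + y * c + z * c + y * z * c) * (c + y * c)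
          = -((c + c * y + z + z * (c + c * y)) * c)
            - y * (c + c * y + z + z * (c + c * y)) * c := by noncomm_ring
      rw [this, hz2]; simp
  have h4 := isQuasiregular_circle (ha x) h3
  have : b * x + y * (b * x) + a * x + a * x * (b * x + y * (b * x))
      = (a + b) * x + (y + a * x + a * x * y) * (b * x) := by noncomm_ring
  rw [this, h1] at h4
  simpa using h4

end Quasiregular

section Radical

variable (F : Type u) [Field F] (A : Type v) [NonUnitalRing A] [Module F A]
  [IsScalarTower F A A] [SMulCommClass F A A]

/-- The Jacobson radical `J(A)` of an algebra `A` that need not have an identity element: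
the elements `a` such that every element of `aA` is quasi-invertible. -/
def radical : Submodule F A where
  carrier := {a | ∀ b : A, IsQuasiregular (a * b)}
  zero_mem' b := by rw [zero_mul]; exact ⟨1, rfl⟩
  add_mem' ha hb := isQuasiregular_add_mul ha hb
  smul_mem' c a ha b := by rw [smul_mul_assoc, ← mul_smul_comm]; exact ha (c • b)

/-- The powers of the radical: `J ^ 0 = A`, `J ^ 1 = J` and `J ^ (n + 1)` is spanned by the
products of an element of `J ^ n` and an element of `J`. -/
def radicalPow : ℕ → Submodule F A
  | 0 => ⊤
  | 1 => radical F A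
  | n + 2 => Submodule.span F
      {c | ∃ a ∈ radicalPow (n + 1), ∃ b ∈ radical F A, c = a * b}

/-- The nilpotency index `n_A` of the radical: the least `n ≥ 1` with `J ^ n = 0`
(such an `n` exists for every finite-dimensional algebra; `n_A = 1` if `J = 0`). -/
noncomputable def radicalIndex : ℕ := sInf {n : ℕ | 1 ≤ n ∧ radicalPow F A n = ⊥}

/-- `d(A) = dim_F (A / J(A))`, the dimension of a semisimple subalgebra supplementing `J(A)`. -/
noncomputable def semisimpleDim : ℕ := Module.finrank F (A ⧸ radical F A)

/-- The parameter `Par(A) = (d(A), n_A - 1)`, a point of `ℕ × ℕ` with the lexicographic order. -/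
noncomputable def par : ℕ ×ₗ ℕ := toLex (semisimpleDim F A, radicalIndex F A - 1)

end Radical

/-! ## Noncommutative polynomials, identities, and alternation -/

section Polynomials

/-- `F⟨X⟩`: polynomials without constant term in the noncommuting variables `x_0, x_1, …`, that is,
the free associative `F`-algebra without identity element; its monomials are the nonempty words. -/
abbrev NCPoly (F : Type u) [Field F] : Type u := MonoidAlgebra F (FreeSemigroup ℕ)

variable {F : Type u} [Field F]

/-- The evaluation `x_i ↦ a i` of polynomials in an algebra. -/
noncomputable def evalAt {A : Type v} [NonUnitalRing A] [Module F A] [IsScalarTower F A A]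
    [SMulCommClass F A A] (a : ℕ → A) : NCPoly F →ₙₐ[F] A :=
  MonoidAlgebra.liftMagma F (FreeSemigroup.lift a)

/-- The substitution `x_i ↦ x_(π i)` of variables. -/
noncomputable def rename (π : ℕ → ℕ) : NCPoly F →ₙₐ[F] NCPoly F :=
  evalAt fun i => MonoidAlgebra.single (FreeSemigroup.of (π i)) 1

variable (F) in
/-- `Id(A)`: the polynomial identities of `A`. -/
def identities (A : Type v) [NonUnitalRing A] [Module F A] [IsScalarTower F A A]
    [SMulCommClass F A A] : Set (NCPoly F) :=
  {f | ∀ a : ℕ → A, evalAt a f = 0}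

/-- The variables of a monomial, with multiplicity. -/
def wordVars (w : FreeSemigroup ℕ) : Multiset ℕ := w.head ::ₘ (w.tail : Multiset ℕ)

/-- `f` is a multilinear polynomial: for some finite set `S` of variables, every monomial of `f`
contains every variable in `S` exactly once, and no other variable. -/
def IsMultilinear (f : NCPoly F) : Prop :=
  ∃ S : Finset ℕ, ∀ w ∈ f.coeff.support, wordVars w = S.val

/-- `f` is multilinear on the set of variables `T`: every monomial of `f` contains every variable
in `T` exactly once (and possibly other variables). -/
def IsMultilinearOn (f : NCPoly F) (T : Finset ℕ) : Prop :=
  ∀ w ∈ f.coeff.support, ∀ i ∈ T, (wordVars w).count i = 1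

/-- `f` is alternating on the set of variables `T`: it is multilinear on `T` and of the form
`∑_σ sign(σ) h(x_σ(i), …)`, the sum over the permutations `σ` of `T`, with `h` multilinear
on `T`. -/
def IsAlternatingOn (f : NCPoly F) (T : Finset ℕ) : Prop :=
  IsMultilinearOn f T ∧ ∃ h : NCPoly F, IsMultilinearOn h T ∧
    f = ∑ σ : Equiv.Perm T,
      ((Equiv.Perm.sign σ : ℤˣ) : ℤ) • rename (⇑(Equiv.Perm.ofSubtype σ)) h

/-- `X 0, …, X (m - 1)` are pairwise disjoint sets of `k` variables each, and `f` is alternating on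
each of them. -/
def IsAlternatingFamily (f : NCPoly F) (k : ℕ) {m : ℕ} (X : Fin m → Finset ℕ) : Prop :=
  (∀ i j, i ≠ j → Disjoint (X i) (X j)) ∧ ∀ i, (X i).card = k ∧ IsAlternatingOn f (X i)

end Polynomials

/-- A finite-dimensional algebra `A` over `F` is basic if it is not PI equivalent (i.e. does not
have the same identities) to a product `B_1 × ⋯ × B_r` (`r ≥ 1`) of finite-dimensional algebras
over `F` with `Par(B_i) < Par(A)` for all `i`. If `A` is nonzero, then every finite-dimensional
`F`-algebra is isomorphic to one in the universe of `A`, so nothing is lost by taking the `B_i`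
there. -/
def IsBasic (F : Type u) [Field F] (A : Type v) [NonUnitalRing A] [Module F A]
    [IsScalarTower F A A] [SMulCommClass F A A] : Prop :=
  ¬ ∃ (r : ℕ) (_ : 1 ≤ r) (B : Fin r → Type v) (_ : ∀ i, NonUnitalRing (B i))
      (_ : ∀ i, Module F (B i)) (_ : ∀ i, IsScalarTower F (B i) (B i))
      (_ : ∀ i, SMulCommClass F (B i) (B i)),
      (∀ i, FiniteDimensional F (B i)) ∧
      (∀ i, par F (B i) < par F A) ∧
      identities F A = identities F (∀ i, B i)

end PIAlgebra

/-! Write J for the radical, d for d(A) and s = n_A - 1. By Wedderburn's principal theorem A is J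
plus a semisimple part with d matrix units as a basis. The matrix units are lifted in the
unitization, where they sum to 1 and so also give a Peirce decomposition of J; one extra block of
size one, the base, lies outside A.

Basicness is used once (`IsBasic.exists_full_multilinear`), on algebras that satisfy the identities
of A and have smaller parameter: for each simple block the subalgebra without that block (d drops),
and the algebra ss + Jt + Jt^2 + ... modulo t^s, where ss is the semisimple part (the nilpotency
index drops, or d if J = 0). Characteristic zero reduces identities to multilinear ones, so some
multilinear f vanishes on all of these algebras but not on A. Fix a nonzero value of f on matrix
units and Peirce components of J (`exists_fullEvaluation`). Every block must occur, since otherwise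
the value lies in a subalgebra with a deleted block. The truncation forces at least s radical
values, and J^(s+1) = 0 allows at most s. Moreover f dies as soon as one of these s values is
replaced by a matrix unit.

Alternation is then inserted (`Insertion`). For each of the ν + s sets and each matrix unit b, a
word y z y' with value u b v = E P P is placed next to a host variable whose value absorbs E P P. A
small set consists of d middle variables z; a big set contains in addition one of the s radical
variables. In the alternating sum only the identity permutation survives
(`Insertion.evalAt_perm_eq_zero`): a wrong matrix unit between u and v gives 0; a radical host value
between them gives 0 because it connects different blocks; and moving the value of any other radical
variable puts a matrix unit in its place, where f vanishes.

This needs each block to touch a radical variable connecting it to a different block, or to the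
base. If some block does not, a nonzero monomial cannot leave that block, so it is the only one. The
words then go in front of a new last variable with value E P P.

The bound on big sets holds for every multilinear non-identity (`card_le_of_isAlternatingFamily`): d
+ 1 alternating variables with values among d matrix units and J must include a radical value, so
n_A disjoint sets give a product in J^n_A = 0. -/

set_option linter.unusedSectionVars false

namespace PIAlgebra

/-! ### Values of polynomials, computed word by word -/

section Evaluation

variable {F : Type u} [Field F] {A : Type v} [NonUnitalRing A] [Module F A]
  [IsScalarTower F A A] [SMulCommClass F A A]

/-- The letters of a word, in order. -/
def letters (w : FreeSemigroup ℕ) : List ℕ := w.head :: w.tail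

theorem letters_mul (w z : FreeSemigroup ℕ) : letters (w * z) = letters w ++ letters z := by
  simp [letters]

theorem coe_letters (w : FreeSemigroup ℕ) : (letters w : Multiset ℕ) = wordVars w := rfl

theorem wordVars_mul (w z : FreeSemigroup ℕ) : wordVars (w * z) = wordVars w + wordVars z := by
  simp [← coe_letters, letters_mul]

theorem letters_lift (φ : ℕ → FreeSemigroup ℕ) (w : FreeSemigroup ℕ) :
    letters (FreeSemigroup.lift φ w) = (letters w).flatMap fun i => letters (φ i) := by
  induction w using FreeSemigroup.recOnMul with
  | ih1 i => simp [letters]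
  | ih2 x y hx hy => rw [map_mul, letters_mul, letters_mul, List.flatMap_append, hx, hy]

theorem evalAt_eq_sum (a : ℕ → A) (f : NCPoly F) :
    evalAt a f = ∑ w ∈ f.coeff.support, f.coeff w • FreeSemigroup.lift a w := by
  simp [evalAt, Finsupp.liftAddHom, Finsupp.sum]

theorem evalAt_single (a : ℕ → A) (w : FreeSemigroup ℕ) (c : F) :
    evalAt a (MonoidAlgebra.single w c) = c • FreeSemigroup.lift a w := by
  simp [evalAt]

theorem evalAt_eq_zero_of_words {a : ℕ → A} {f : NCPoly F}
    (h : ∀ w ∈ f.coeff.support, FreeSemigroup.lift a w = 0) : evalAt a f = 0 := by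
  rw [evalAt_eq_sum]
  exact Finset.sum_eq_zero fun w hw => by rw [h w hw, smul_zero]

theorem map_lift {B : Type*} [NonUnitalRing B] {G : Type*} [FunLike G A B] [MulHomClass G A B]
    (φ : G) (a : ℕ → A) (w : FreeSemigroup ℕ) :
    φ (FreeSemigroup.lift a w) = FreeSemigroup.lift (fun i => φ (a i)) w := by
  induction w using FreeSemigroup.recOnMul with
  | ih1 i => simp
  | ih2 x y hx hy => simp only [map_mul]; rw [hy]; congr 1

theorem map_evalAt {B : Type*} [NonUnitalRing B] [Module F B] [IsScalarTower F B B]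
    [SMulCommClass F B B] (φ : A →ₙₐ[F] B) (a : ℕ → A) (f : NCPoly F) :
    φ (evalAt a f) = evalAt (fun i => φ (a i)) f := by
  simp only [evalAt_eq_sum, map_sum, map_smul, map_lift]

/-- In the unitization the value of a word is a list product with a unit available, so it can be cut
at any letter. -/
theorem inr_lift (a : ℕ → A) (w : FreeSemigroup ℕ) :
    ((FreeSemigroup.lift a w : A) : Unitization F A)
      = ((letters w).map fun i => (a i : Unitization F A)).prod := by
  induction w using FreeSemigroup.recOnMul with
  | ih1 i => simp [letters]
  | ih2 x y hx hy =>
    rw [map_mul, Unitization.inr_mul, letters_mul, List.map_append, List.prod_append, ← hy]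
    congr 1

theorem inr_evalAt (a : ℕ → A) (f : NCPoly F) :
    ((evalAt a f : A) : Unitization F A) = ∑ w ∈ f.coeff.support,
      f.coeff w • ((letters w).map fun i => (a i : Unitization F A)).prod := by
  change Unitization.inrNonUnitalAlgHom F A (evalAt a f) = _
  rw [evalAt_eq_sum, map_sum]
  refine Finset.sum_congr rfl fun w _ => ?_
  rw [map_smul, ← inr_lift]
  rfl

theorem lift_congr {a b : ℕ → A} {w : FreeSemigroup ℕ} (h : ∀ i ∈ wordVars w, a i = b i) :
    FreeSemigroup.lift a w = FreeSemigroup.lift b w := by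
  induction w using FreeSemigroup.recOnMul with
  | ih1 i => exact h i (by simp [wordVars, FreeSemigroup.of])
  | ih2 x y hx hy =>
    simp only [wordVars_mul, Multiset.mem_add] at h
    rw [map_mul, map_mul, hy fun i hi => h i (Or.inr hi)]
    congr 1
    exact hx fun i hi => h i (Or.inl hi)

theorem evalAt_congr {a b : ℕ → A} {f : NCPoly F}
    (h : ∀ w ∈ f.coeff.support, ∀ i ∈ wordVars w, a i = b i) : evalAt a f = evalAt b f := by
  rw [evalAt_eq_sum, evalAt_eq_sum]
  exact Finset.sum_congr rfl fun w hw => by rw [lift_congr (h w hw)]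

theorem lift_smul (c : ℕ → F) (a : ℕ → A) (w : FreeSemigroup ℕ) :
    FreeSemigroup.lift (fun i => c i • a i) w
      = ((wordVars w).map c).prod • FreeSemigroup.lift a w := by
  induction w using FreeSemigroup.recOnMul with
  | ih1 i => rw [FreeSemigroup.lift_of, FreeSemigroup.lift_of]; simp [wordVars, FreeSemigroup.of]
  | ih2 x y hx hy =>
    rw [map_mul, map_mul, wordVars_mul, Multiset.map_add, Multiset.prod_add, hy]
    erw [hx]
    rw [smul_mul_smul_comm]

theorem evalAt_smul_of_wordVars {α : Multiset ℕ} {f : NCPoly F}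
    (hf : ∀ w ∈ f.coeff.support, wordVars w = α) (c : ℕ → F) (a : ℕ → A) :
    evalAt (fun i => c i • a i) f = (α.map c).prod • evalAt a f := by
  rw [evalAt_eq_sum, evalAt_eq_sum, Finset.smul_sum]
  refine Finset.sum_congr rfl fun w hw => ?_
  rw [lift_smul, hf w hw, smul_comm]

end Evaluation

/-! ### Multihomogeneous components of identities -/

section Multihomogeneous

variable {F : Type u} [Field F]

open Classical in
/-- The multihomogeneous component of multidegree `α`. -/
noncomputable def homComponent (α : Multiset ℕ) (f : NCPoly F) : NCPoly F :=
  MonoidAlgebra.ofCoeff (f.coeff.filter fun w => wordVars w = α)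

theorem wordVars_of_mem_homComponent {α : Multiset ℕ} {f : NCPoly F} {w : FreeSemigroup ℕ}
    (hw : w ∈ (homComponent α f).coeff.support) : wordVars w = α := by
  classical
  simp only [homComponent, MonoidAlgebra.coeff_ofCoeff, Finsupp.support_filter,
    Finset.mem_filter] at hw
  exact hw.2

open Classical in
theorem sum_homComponent (f : NCPoly F) :
    ∑ α ∈ f.coeff.support.image wordVars, homComponent α f = f := by
  refine MonoidAlgebra.coeff_injective ?_
  ext w
  simp only [MonoidAlgebra.coeff_sum, Finsupp.coe_finsetSum, Finset.sum_apply, homComponent,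
    Finsupp.filter_apply]
  rw [Finset.sum_ite_eq]
  split_ifs with h
  · rfl
  · by_contra h2
    exact h (Finset.mem_image_of_mem _ (Finsupp.mem_support_iff.2 fun h3 => h2 h3.symm))

theorem homComponent_eq_zero {α : Multiset ℕ} {f : NCPoly F}
    (h : α ∉ f.coeff.support.image wordVars) : homComponent α f = 0 := by
  classical
  refine MonoidAlgebra.coeff_injective ?_
  ext w
  simp only [homComponent, MonoidAlgebra.coeff_ofCoeff, Finsupp.filter_apply]
  split_ifs with h2
  · by_contra h3
    refine h (Finset.mem_image.2 ⟨w, Finsupp.mem_support_iff.2 h3, h2⟩)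
  · rfl

variable {A : Type v} [NonUnitalRing A] [Module F A] [IsScalarTower F A A] [SMulCommClass F A A]

/-- Scaling each variable by `c i` multiplies the component of multidegree `α` by the monomial of
`c` with exponent `α`. Seen through a functional, the scaled value is thus a commutative polynomial
in `c` whose coefficients are the values of the components. -/
theorem exists_mvPolynomial_evalAt_smul (f : NCPoly F) (a : ℕ → A) (φ : A →ₗ[F] F) :
    ∃ p : MvPolynomial ℕ F,
      (∀ c, MvPolynomial.eval c p = φ (evalAt (fun i => c i • a i) f)) ∧
      ∀ α : Multiset ℕ, p.coeff (Multiset.toFinsupp α) = φ (evalAt a (homComponent α f)) := by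
  classical
  refine ⟨∑ α ∈ f.coeff.support.image wordVars,
    MvPolynomial.monomial (Multiset.toFinsupp α) (φ (evalAt a (homComponent α f))), ?_, ?_⟩
  · intro c
    conv_rhs => rw [← sum_homComponent f]
    rw [map_sum, map_sum, map_sum]
    refine Finset.sum_congr rfl fun α _ => ?_
    rw [evalAt_smul_of_wordVars (fun w hw => wordVars_of_mem_homComponent hw), map_smul,
      MvPolynomial.eval_monomial, smul_eq_mul, mul_comm]
    congr 1
    rw [Finset.prod_multiset_map_count, Finsupp.prod, Multiset.toFinsupp_support]
    simp only [Multiset.toFinsupp_apply]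
  · intro α
    rw [MvPolynomial.coeff_sum]
    simp only [MvPolynomial.coeff_monomial]
    by_cases h : α ∈ f.coeff.support.image wordVars
    · rw [Finset.sum_eq_single α]
      · simp
      · intro b _ hb
        rw [if_neg]
        intro h2
        exact hb (Multiset.toFinsupp.injective h2)
      · exact fun h2 => absurd h h2
    · rw [homComponent_eq_zero h, map_zero, map_zero]
      refine Finset.sum_eq_zero fun b hb => if_neg fun h2 => h ?_
      rwa [← Multiset.toFinsupp.injective h2]

/-- Over an infinite field a commutative polynomial that vanishes at all points has zero
coefficients. -/
theorem homComponent_mem_identities [Infinite F] {f : NCPoly F} (hf : f ∈ identities F A)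
    (α : Multiset ℕ) : homComponent α f ∈ identities F A := by
  intro a
  rw [← Module.forall_dual_apply_eq_zero_iff F]
  intro φ
  obtain ⟨p, hp, hc⟩ := exists_mvPolynomial_evalAt_smul f a φ
  have : p = 0 := MvPolynomial.funext fun c => by rw [hp, hf, map_zero, map_zero]
  rw [← hc, this, MvPolynomial.coeff_zero]

end Multihomogeneous

/-! ### Full linearization in characteristic zero -/

section Multilinearization

open MvPolynomial in
-- Over ℕ nothing cancels, and taking the `k`-th variable from the `k`-th factor already yields the
-- squarefree monomial. Its coefficient is a positive integer, nonzero in characteristic zero.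
theorem coeff_prod_sum_X_ne_zero (F : Type u) [Field F] [CharZero F] {m : ℕ}
    (C : Fin m → Finset (Fin m)) (hC : ∀ k, k ∈ C k) :
    MvPolynomial.coeff (Multiset.toFinsupp (Finset.range m).val)
      (∏ k, ∑ j ∈ C k, (X (j : ℕ) : MvPolynomial ℕ F)) ≠ 0 := by
  have key : MvPolynomial.coeff (Multiset.toFinsupp (Finset.range m).val)
      (∏ k, ∑ j ∈ C k, (X (j : ℕ) : MvPolynomial ℕ ℕ)) ≠ 0 := by
    classical
    have h1 : ∀ k, ∑ j ∈ C k, (X (j : ℕ) : MvPolynomial ℕ ℕ)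
        = X (k : ℕ) + ∑ j ∈ (C k).erase k, X (j : ℕ) := fun k =>
      (Finset.add_sum_erase _ _ (hC k)).symm
    simp only [h1]
    rw [Finset.prod_add, MvPolynomial.coeff_sum]
    refine (Finset.sum_pos' (fun _ _ => Nat.zero_le _) ⟨Finset.univ, by simp, ?_⟩).ne'
    have : (∏ a : Fin m, (X (a : ℕ) : MvPolynomial ℕ ℕ))
        = monomial (Multiset.toFinsupp (Finset.range m).val) 1 := by
      rw [Finset.prod_fin_eq_prod_range]
      rw [Finset.prod_congr rfl (g := fun i => (X i : MvPolynomial ℕ ℕ))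
        fun i hi => dif_pos (Finset.mem_range.1 hi)]
      rw [MvPolynomial.monomial_eq, map_one, one_mul, Finsupp.prod, Multiset.toFinsupp_support]
      refine Finset.prod_congr (by simp) fun i hi => ?_
      rw [Multiset.toFinsupp_apply, Multiset.count_eq_one_of_mem (Finset.range m).nodup, pow_one]
      simpa using hi
    simp [this, MvPolynomial.coeff_monomial]
  intro h
  apply key
  have := congrArg (MvPolynomial.coeff (Multiset.toFinsupp (Finset.range m).val))
    (show MvPolynomial.map (Nat.castRingHom F) (∏ k, ∑ j ∈ C k, (X (j : ℕ) : MvPolynomial ℕ ℕ))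
      = ∏ k, ∑ j ∈ C k, (X (j : ℕ) : MvPolynomial ℕ F) by simp)
  rw [h, MvPolynomial.coeff_map] at this
  simpa using this

variable {F : Type u} [Field F]

theorem isMultilinear_homComponent (S : Finset ℕ) (f : NCPoly F) :
    IsMultilinear (homComponent S.val f) :=
  ⟨S, fun _ hw => wordVars_of_mem_homComponent hw⟩

/-- In characteristic zero the identities are determined by the multilinear ones. -/
theorem identities_subset_of_multilinear [CharZero F] {P Q : Type*} [NonUnitalRing P] [Module F P]
    [IsScalarTower F P P] [SMulCommClass F P P] [NonUnitalRing Q] [Module F Q]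
    [IsScalarTower F Q Q] [SMulCommClass F Q Q]
    (h : ∀ g : NCPoly F, IsMultilinear g → g ∈ identities F P → g ∈ identities F Q) :
    identities F P ⊆ identities F Q := by
  classical
  intro f hf a
  rw [← sum_homComponent f, map_sum]
  refine Finset.sum_eq_zero fun α _ => ?_
  by_contra hne
  obtain ⟨l, rfl⟩ := Quot.exists_rep α
  set fα := homComponent (Quot.mk _ l) f with hfα
  have hw : ∀ w ∈ fα.coeff.support, wordVars w = (l : Multiset ℕ) := fun w hw =>
    wordVars_of_mem_homComponent hw
  have hfP : fα ∈ identities F P := homComponent_mem_identities hf _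
  rw [← Module.forall_dual_apply_eq_zero_iff F] at hne
  push Not at hne
  obtain ⟨φ, hφ⟩ := hne
  -- Linearization: the letter `n` is replaced by the sum of new variables, one for each position of
  -- `l` holding `n`. The multilinear component of the result is the test polynomial.
  let C : ℕ → Finset (Fin l.length) := fun n => Finset.univ.filter fun j => l.get j = n
  let y : ℕ → NCPoly F := fun n => ∑ j ∈ C n, MonoidAlgebra.single (FreeSemigroup.of (j : ℕ)) 1
  set g := evalAt y fα
  have hgP : g ∈ identities F P := fun b => by rw [map_evalAt]; exact hfP _
  have hg0 := h _ (isMultilinear_homComponent (Finset.range l.length) g)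
    (homComponent_mem_identities hgP _)
  obtain ⟨p, hp, hc⟩ := exists_mvPolynomial_evalAt_smul g (fun j => a (l.getD j 0)) φ
  -- With the `j`-th new variable set to `c j` times the value of the `j`-th letter of `l`, the
  -- polynomial becomes the original value times a product of linear forms in `c`. Comparing
  -- squarefree coefficients recovers a nonzero integer multiple of the original value.
  have h1 : p = MvPolynomial.C (φ (evalAt a fα)) *
      ∏ k : Fin l.length, ∑ j ∈ C (l.get k), MvPolynomial.X (j : ℕ) := by
    refine MvPolynomial.funext fun c => ?_
    have h2 : (fun n => evalAt (fun i => c i • a (l.getD i 0)) (y n))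
        = fun n => (∑ j ∈ C n, c j) • a n := by
      funext n
      simp only [y, map_sum, evalAt_single, FreeSemigroup.lift_of, one_smul, Finset.sum_smul]
      refine Finset.sum_congr rfl fun j hj => ?_
      simp only [C, Finset.mem_filter, Finset.mem_univ, true_and, List.get_eq_getElem] at hj
      rw [List.getD_eq_getElem _ _ j.2, hj]
    rw [hp, map_evalAt, h2, evalAt_smul_of_wordVars hw, map_smul, smul_eq_mul, mul_comm]
    simp only [map_mul, MvPolynomial.eval_C, map_prod, map_sum, MvPolynomial.eval_X]
    congr 1
    rw [Multiset.map_coe, Multiset.prod_coe]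
    generalize hG : (fun n => ∑ j ∈ C n, c (j : ℕ)) = G
    rw [show (∏ k : Fin l.length, ∑ j ∈ C (l.get k), c (j : ℕ)) = ∏ k : Fin l.length, G (l.get k)
      by rw [← hG], ← List.prod_ofFn]
    congr 1
    conv_lhs => rw [← List.ofFn_get l, List.map_ofFn]
    rfl
  have h3 := hc (Finset.range l.length).val
  rw [hg0, map_zero, h1, MvPolynomial.coeff_C_mul] at h3
  exact mul_ne_zero hφ (coeff_prod_sum_X_ne_zero F _ fun k => by simp [C]) h3

end Multilinearization

/-! ### Linearity in each variable, and reduction to spanning sets -/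

section Multilinear

variable {F : Type u} [Field F] {A : Type v} [NonUnitalRing A] [Module F A]
  [IsScalarTower F A A] [SMulCommClass F A A]

/-- A letter occurring once splits the word into a prefix and a suffix that do not see its value. -/
theorem exists_inr_lift_update (a : ℕ → A) {k : ℕ} {w : FreeSemigroup ℕ}
    (hw : (wordVars w).count k = 1) :
    ∃ p q : Unitization F A, ∀ x,
      ((FreeSemigroup.lift (Function.update a k x) w : A) : Unitization F A) = p * x * q := by
  have hk : k ∈ letters w := by
    rw [← Multiset.mem_coe, coe_letters, ← Multiset.one_le_count_iff_mem, hw]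
  obtain ⟨l, m, hlm⟩ := List.append_of_mem hk
  rw [← coe_letters, Multiset.coe_count, hlm, List.count_append, List.count_cons_self] at hw
  have hl : k ∉ l := List.count_eq_zero.1 (by omega)
  have hm : k ∉ m := List.count_eq_zero.1 (by omega)
  refine ⟨(l.map fun i => (a i : Unitization F A)).prod,
    (m.map fun i => (a i : Unitization F A)).prod, fun x => ?_⟩
  rw [inr_lift, hlm, List.map_append, List.prod_append, List.map_cons, List.prod_cons,
    Function.update_self, mul_assoc]
  congr 2
  · refine List.map_congr_left fun i hi => ?_
    rw [Function.update_of_ne (by rintro rfl; exact hl hi)]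
  · refine congrArg _ (List.map_congr_left fun i hi => ?_)
    rw [Function.update_of_ne (by rintro rfl; exact hm hi)]

theorem exists_linearMap_evalAt_update {f : NCPoly F} {k : ℕ}
    (hf : ∀ w ∈ f.coeff.support, (wordVars w).count k = 1) (a : ℕ → A) :
    ∃ L : A →ₗ[F] A, ∀ x, evalAt (Function.update a k x) f = L x := by
  have hadd : ∀ w ∈ f.coeff.support, ∀ x y : A, FreeSemigroup.lift (Function.update a k (x + y)) w
      = FreeSemigroup.lift (Function.update a k x) w
        + FreeSemigroup.lift (Function.update a k y) w := fun w hw x y => by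
    obtain ⟨p, q, hpq⟩ := exists_inr_lift_update (F := F) a (hf w hw)
    apply Unitization.inr_injective (R := F)
    rw [Unitization.inr_add, hpq, hpq, hpq, Unitization.inr_add, mul_add, add_mul]
  have hsmul : ∀ w ∈ f.coeff.support, ∀ (c : F) (x : A),
      FreeSemigroup.lift (Function.update a k (c • x)) w
        = c • FreeSemigroup.lift (Function.update a k x) w := fun w hw c x => by
    obtain ⟨p, q, hpq⟩ := exists_inr_lift_update (F := F) a (hf w hw)
    apply Unitization.inr_injective (R := F)
    rw [Unitization.inr_smul, hpq, hpq, Unitization.inr_smul, mul_smul_comm, smul_mul_assoc]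
  refine ⟨⟨⟨fun x => evalAt (Function.update a k x) f, fun x y => ?_⟩, fun c x => ?_⟩,
    fun x => rfl⟩
  · simp only [evalAt_eq_sum]
    rw [← Finset.sum_add_distrib]
    exact Finset.sum_congr rfl fun w hw => by rw [hadd w hw, smul_add]
  · simp only [evalAt_eq_sum, RingHom.id_apply]
    rw [Finset.smul_sum]
    exact Finset.sum_congr rfl fun w hw => by rw [hsmul w hw, smul_comm]

theorem count_eq_one_of_wordVars {S : Finset ℕ} {w : FreeSemigroup ℕ} (hw : wordVars w = S.val)
    {k : ℕ} (hk : k ∈ S) : (wordVars w).count k = 1 := by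
  rw [hw, Multiset.count_eq_one_of_mem S.nodup hk]

theorem evalAt_eq_zero_of_zero {f : NCPoly F} {S : Finset ℕ}
    (hf : ∀ w ∈ f.coeff.support, wordVars w = S.val) {a : ℕ → A} {k : ℕ} (hk : k ∈ S)
    (ha : a k = 0) : evalAt a f = 0 := by
  obtain ⟨L, hL⟩ := exists_linearMap_evalAt_update (k := k)
    (fun w hw => count_eq_one_of_wordVars (hf w hw) hk) a
  have := hL (a k)
  rwa [Function.update_eq_self, ha, map_zero] at this

/-- A multilinear polynomial that vanishes on a spanning set vanishes. -/
theorem evalAt_eq_zero_of_span {f : NCPoly F} {S : Finset ℕ}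
    (hf : ∀ w ∈ f.coeff.support, wordVars w = S.val) {B : Set A}
    (hB : Submodule.span F B = ⊤) (h : ∀ a : ℕ → A, (∀ k ∈ S, a k ∈ B) → evalAt a f = 0)
    (a : ℕ → A) : evalAt a f = 0 := by
  classical
  have key : ∀ T ⊆ S, ∀ a : ℕ → A, (∀ k ∈ S \ T, a k ∈ B) → evalAt a f = 0 := by
    intro T
    induction T using Finset.induction_on with
    | empty => exact fun _ a ha => h a fun k hk => ha k (by simpa using hk)
    | insert k T hk ih =>
      intro hT a ha
      have hkS : k ∈ S := hT (Finset.mem_insert_self _ _)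
      obtain ⟨L, hL⟩ := exists_linearMap_evalAt_update (k := k)
        (fun w hw => count_eq_one_of_wordVars (hf w hw) hkS) a
      have h0 : L = 0 := by
        refine LinearMap.ext_on hB fun x hx => ?_
        rw [← hL]
        refine ih (fun i hi => hT (Finset.mem_insert_of_mem hi)) _ fun i hi => ?_
        by_cases hik : i = k
        · rw [hik, Function.update_self]; exact hx
        · rw [Function.update_of_ne hik]
          rw [Finset.mem_sdiff] at hi
          exact ha i (by simp [hi.1, hi.2, hik])
      have := hL (a k)
      rwa [Function.update_eq_self, h0, LinearMap.zero_apply] at this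
  exact key S subset_rfl a (by simp)

end Multilinear

/-! ### Bounding the parameter by a nilpotent filtration -/

section Filtration

variable {F : Type u} [Field F] {A : Type v} [NonUnitalRing A] [Module F A]
  [IsScalarTower F A A] [SMulCommClass F A A]

theorem isQuasiregular_of_isNilpotent_inr {x : A}
    (hx : IsNilpotent (x : Unitization F A)) : IsQuasiregular x := by
  rw [← Unitization.isQuasiregular_inr_iff (R := F), isQuasiregular_iff_isUnit]
  exact hx.isUnit_one_add

theorem radicalPow_succ {k : ℕ} (hk : 1 ≤ k) : radicalPow F A (k + 1)
    = Submodule.span F {c | ∃ a ∈ radicalPow F A k, ∃ b ∈ radical F A, c = a * b} := by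
  obtain ⟨k, rfl⟩ := Nat.exists_eq_add_of_le' hk
  rfl

theorem radicalPow_le_of_filtration {N : ℕ → Submodule F A} (hN : radical F A ≤ N 1)
    (hm : ∀ i, 1 ≤ i → ∀ x ∈ N i, ∀ y ∈ N 1, x * y ∈ N (i + 1)) {k : ℕ} (hk : 1 ≤ k) :
    radicalPow F A k ≤ N k := by
  induction k, hk using Nat.le_induction with
  | base => exact hN
  | succ k hk ih =>
    rw [radicalPow_succ hk, Submodule.span_le]
    rintro _ ⟨a, ha, b, hb, rfl⟩
    exact hm k hk a (ih ha) b (hN hb)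

/-- The powers of `x * b` climb the filtration, so `x * b` is nilpotent and hence quasiregular. -/
theorem le_radical_of_filtration {N : ℕ → Submodule F A}
    (hr : ∀ x ∈ N 1, ∀ b, x * b ∈ N 1)
    (hm : ∀ i, 1 ≤ i → ∀ x ∈ N i, ∀ y ∈ N 1, x * y ∈ N (i + 1)) {k : ℕ} (hk : 1 ≤ k)
    (h0 : N k = ⊥) : N 1 ≤ radical F A := by
  intro x hx b
  apply isQuasiregular_of_isNilpotent_inr (F := F)
  have key : ∀ i, 1 ≤ i → ∃ y ∈ N i, ((x * b : A) : Unitization F A) ^ i = y := by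
    intro i hi
    induction i, hi using Nat.le_induction with
    | base => exact ⟨_, hr x hx b, pow_one _⟩
    | succ i hi ih =>
      obtain ⟨y, hy, hxy⟩ := ih
      exact ⟨_, hm i hi y hy _ (hr x hx b), by rw [_root_.pow_succ, hxy, Unitization.inr_mul, Unitization.inr_mul,
        Unitization.inr_mul]⟩
  obtain ⟨y, hy, hxy⟩ := key k hk
  rw [h0, Submodule.mem_bot] at hy
  exact ⟨k, by rw [hxy, hy, Unitization.inr_zero]⟩

/-- A nilpotent right ideal bounds the parameter. -/
theorem par_le_of_filtration [FiniteDimensional F A] {N : ℕ → Submodule F A}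
    (hr : ∀ x ∈ N 1, ∀ b, x * b ∈ N 1)
    (hm : ∀ i, 1 ≤ i → ∀ x ∈ N i, ∀ y ∈ N 1, x * y ∈ N (i + 1)) {k : ℕ} (hk : 1 ≤ k)
    (h0 : N k = ⊥) :
    par F A ≤ toLex (Module.finrank F A - Module.finrank F (N 1), k - 1) := by
  have hle := le_radical_of_filtration hr hm hk h0
  have hd : semisimpleDim F A = Module.finrank F A - Module.finrank F (radical F A) := by
    have := Submodule.finrank_quotient_add_finrank (radical F A)
    rw [semisimpleDim]; omega
  have h1 := Submodule.finrank_mono hle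
  have h2 := Submodule.finrank_le (radical F A)
  -- If `N 1` is strictly smaller than the radical, the first coordinate is strictly smaller. If
  -- they are equal, the filtration dominates the powers of the radical and bounds the index.
  rw [par, Prod.Lex.toLex_le_toLex, hd]
  rcases h1.lt_or_eq with h | h
  · left; simp only; omega
  · right
    refine ⟨by simp only; omega, ?_⟩
    have heq : N 1 = radical F A := Submodule.eq_of_le_of_finrank_eq hle h
    have : radicalIndex F A ≤ k := Nat.sInf_le ⟨hk, by
      rw [eq_bot_iff, ← h0]
      exact radicalPow_le_of_filtration heq.ge hm hk⟩
    simp only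
    omega

end Filtration

/-! ### The radical as the Jacobson radical of the Artinian unitization -/

section Jacobson

variable (F : Type u) [Field F] (A : Type v) [NonUnitalRing A] [Module F A]
  [IsScalarTower F A A] [SMulCommClass F A A] [FiniteDimensional F A]

theorem finiteDimensional_unitization : FiniteDimensional F (Unitization F A) :=
  Module.Finite.equiv (Unitization.linearEquiv F F A).symm

theorem isArtinianRing_unitization : IsArtinianRing (Unitization F A) :=
  have := finiteDimensional_unitization F A
  IsArtinianRing.of_finite F _

theorem isNilpotent_jacobson_unitization : IsNilpotent (Ring.jacobson (Unitization F A)) :=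
  have := isArtinianRing_unitization F A
  IsSemiprimaryRing.isNilpotent

variable {F A}

theorem isNilpotent_of_mem_jacobson {x : Unitization F A}
    (hx : x ∈ Ring.jacobson (Unitization F A)) : IsNilpotent x := by
  obtain ⟨n, hn⟩ := isNilpotent_jacobson_unitization F A
  exact ⟨n, by simpa [hn] using Ideal.pow_mem_pow hx n⟩

/-- The augmentation sends a nilpotent element to a nilpotent element of the field, which is 0. -/
theorem exists_inr_of_mem_jacobson {x : Unitization F A}
    (hx : x ∈ Ring.jacobson (Unitization F A)) : ∃ a : A, (a : Unitization F A) = x := by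
  have h : IsNilpotent (Unitization.fstHom F A x) := (isNilpotent_of_mem_jacobson hx).map _
  have h2 : x.fst = 0 := h.eq_zero
  exact ⟨x.snd, by conv_rhs => rw [← Unitization.inl_fst_add_inr_snd_eq x, h2, Unitization.inl_zero, zero_add]⟩

theorem mul_inr_eq_inr (y : Unitization F A) (a : A) : ∃ b : A, y * (a : Unitization F A) = b := by
  refine ⟨(y * (a : Unitization F A)).snd, ?_⟩
  conv_lhs => rw [← Unitization.inl_fst_add_inr_snd_eq (y * (a : Unitization F A))]
  simp

theorem inr_mul_eq_inr (a : A) (y : Unitization F A) : ∃ b : A, (a : Unitization F A) * y = b := by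
  refine ⟨((a : Unitization F A) * y).snd, ?_⟩
  conv_lhs => rw [← Unitization.inl_fst_add_inr_snd_eq ((a : Unitization F A) * y)]
  simp

/-- This transfers nilpotency of the radical from Artinian rings. Quasiregularity is only assumed
for products `a * b` with `b` in `A`, while `y` ranges over the unitization; squaring `a * y` turns
it into such a product. -/
theorem mem_radical_iff {a : A} :
    a ∈ radical F A ↔ (a : Unitization F A) ∈ Ring.jacobson (Unitization F A) := by
  constructor
  · intro ha
    rw [← Ideal.jacobson_bot, Ideal.mem_jacobson_iff]
    intro y
    obtain ⟨x, hx⟩ := inr_mul_eq_inr (F := F) a y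
    obtain ⟨b, hb⟩ := inr_mul_eq_inr (F := F) a y
    obtain ⟨c, hc⟩ := mul_inr_eq_inr (F := F) y b
    -- For `x = a * y`, (1 + x)(1 - x) = 1 - a(y a y) with y a y in `A`. This is a unit, and the two
    -- factors commute.
    have h1 : IsUnit (1 + (x : Unitization F A)) := by
      have h2 : IsQuasiregular (a * -c) := ha (-c)
      rw [← Unitization.isQuasiregular_inr_iff (R := F), isQuasiregular_iff_isUnit] at h2
      have h3 : 1 + ((a * -c : A) : Unitization F A)
          = (1 + (x : Unitization F A)) * (1 - (x : Unitization F A)) := by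
        rw [Unitization.inr_mul, Unitization.inr_neg, ← hc, ← hb, ← hx]; noncomm_ring
      rw [h3] at h2
      refine ((Commute.isUnit_mul_iff ?_).1 h2).1
      simp only [Commute, SemiconjBy]; noncomm_ring
    obtain ⟨u, -, hu'⟩ := isUnit_iff_exists.1 h1
    -- The usual passage from an inverse `u` of 1 + a y to a left inverse of 1 + y a.
    refine ⟨1 - y * u * a, ?_⟩
    have : (1 - y * u * a) * y * a + (1 - y * u * a) - 1
        = y * (1 - u * (1 + a * y)) * a := by noncomm_ring
    rw [this, hx, hu']
    simp
  · intro ha b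
    apply isQuasiregular_of_isNilpotent_inr (F := F)
    rw [Unitization.inr_mul]
    exact isNilpotent_of_mem_jacobson (Ideal.mul_mem_right _ _ ha)

theorem mem_radicalPow_iff {k : ℕ} {a : A} :
    a ∈ radicalPow F A k ↔ (a : Unitization F A) ∈ Ring.jacobson (Unitization F A) ^ k := by
  rcases Nat.eq_zero_or_pos k with rfl | hk
  · simp [radicalPow, Submodule.pow_zero]
  induction k, hk using Nat.le_induction generalizing a with
  | base => rw [Nat.succ_eq_add_one, zero_add, Submodule.pow_one]; exact mem_radical_iff
  | succ k hk ih =>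
    rw [radicalPow_succ hk]
    constructor
    · intro ha
      induction ha using Submodule.span_induction with
      | mem x hx =>
        obtain ⟨y, hy, z, hz, rfl⟩ := hx
        rw [Unitization.inr_mul, Submodule.pow_succ]
        exact Ideal.mul_mem_mul (ih.1 hy) (mem_radical_iff.1 hz)
      | zero => rw [Unitization.inr_zero]; exact zero_mem _
      | add x y _ _ hx hy => rw [Unitization.inr_add]; exact add_mem hx hy
      | smul c x _ hx =>
        rw [Unitization.inr_smul, Algebra.smul_def]
        exact Ideal.mul_mem_left _ _ hx
    · intro ha
      have key : ∀ x ∈ Ring.jacobson (Unitization F A) ^ (k + 1), ∃ b ∈ Submodule.span F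
          {c | ∃ a ∈ radicalPow F A k, ∃ b ∈ radical F A, c = a * b},
          (b : Unitization F A) = x := by
        intro x hx
        rw [Submodule.pow_succ] at hx
        refine Submodule.mul_induction_on hx ?_ ?_
        · intro m hm n hn
          obtain ⟨m', rfl⟩ := exists_inr_of_mem_jacobson (Ideal.pow_le_self (by omega) hm)
          obtain ⟨n', rfl⟩ := exists_inr_of_mem_jacobson hn
          exact ⟨m' * n', Submodule.subset_span ⟨m', ih.2 hm, n', mem_radical_iff.2 hn, rfl⟩,
            Unitization.inr_mul _ _ _⟩
        · rintro _ _ ⟨b, hb, rfl⟩ ⟨c, hc, rfl⟩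
          exact ⟨b + c, add_mem hb hc, Unitization.inr_add _ _ _⟩
      obtain ⟨b, hb, hba⟩ := key _ ha
      rwa [← Unitization.inr_injective hba]

variable (F A)

theorem one_le_radicalIndex_and_radicalPow : 1 ≤ radicalIndex F A ∧
    radicalPow F A (radicalIndex F A) = ⊥ := by
  apply Nat.sInf_mem (s := {n | 1 ≤ n ∧ radicalPow F A n = ⊥})
  obtain ⟨n, hn⟩ := isNilpotent_jacobson_unitization F A
  refine ⟨n + 1, by omega, ?_⟩
  rw [eq_bot_iff]
  intro a ha
  rw [mem_radicalPow_iff, Submodule.pow_succ, hn, Submodule.zero_eq_bot, Ideal.bot_mul] at ha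
  exact (Submodule.mem_bot F).2 (Unitization.inr_injective (R := F) (by simpa using ha))

theorem jacobson_pow_radicalIndex :
    Ring.jacobson (Unitization F A) ^ radicalIndex F A = ⊥ := by
  obtain ⟨h1, h2⟩ := one_le_radicalIndex_and_radicalPow F A
  rw [eq_bot_iff]
  intro x hx
  obtain ⟨a, rfl⟩ := exists_inr_of_mem_jacobson (Ideal.pow_le_self (by omega) hx)
  rw [← mem_radicalPow_iff, h2, Submodule.mem_bot] at hx
  rw [hx, Unitization.inr_zero]
  exact zero_mem _

variable {F A}

open Classical in
theorem list_prod_mem_jacobson_pow (l : List (Unitization F A)) :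
    l.prod ∈ Ring.jacobson (Unitization F A) ^
      l.countP (· ∈ Ring.jacobson (Unitization F A)) := by
  induction l with
  | nil => simp [Submodule.pow_zero]
  | cons x l ih =>
    rw [List.prod_cons, List.countP_cons]
    split_ifs with h
    · rw [Ideal.IsTwoSided.pow_succ]
      exact Ideal.mul_mem_mul (by simpa using h) ih
    · exact Ideal.mul_mem_left _ _ ih

open Classical in
/-- A multilinear polynomial vanishes as soon as `n_A` variables take values in the radical. -/
theorem evalAt_eq_zero_of_radicalIndex_le {f : NCPoly F} {S : Finset ℕ}
    (hf : ∀ w ∈ f.coeff.support, wordVars w = S.val) {a : ℕ → A} {W : Finset ℕ} (hW : W ⊆ S)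
    (ha : ∀ k ∈ W, a k ∈ radical F A) (hc : radicalIndex F A ≤ W.card) : evalAt a f = 0 := by
  refine evalAt_eq_zero_of_words fun w hw => ?_
  apply Unitization.inr_injective (R := F)
  rw [inr_lift, Unitization.inr_zero]
  have h1 := list_prod_mem_jacobson_pow ((letters w).map fun i => (a i : Unitization F A))
  have h2 : W.card ≤ ((letters w).map fun i => (a i : Unitization F A)).countP
      (· ∈ Ring.jacobson (Unitization F A)) := by
    rw [List.countP_map, Function.comp_def, ← Multiset.coe_countP, coe_letters, hf w hw,
      Multiset.countP_eq_card_filter]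
    refine Multiset.card_le_card (Multiset.le_iff_subset W.nodup |>.2 fun k hk => ?_)
    rw [Multiset.mem_filter]
    exact ⟨hW hk, by simpa using mem_radical_iff.1 (ha k hk)⟩
  have h3 := Ideal.pow_le_pow_right (hc.trans h2) h1
  rw [jacobson_pow_radicalIndex] at h3
  exact h3

end Jacobson

/-! ## Lifting matrix units, and the Wedderburn principal theorem -/

/-- `m` is a system of matrix units, with one block of matrices for every value of `ty`. -/
structure IsMatrixUnits {ι κ R : Type*} [Fintype ι] [Ring R] (ty : ι → κ) (m : ι → ι → R) :
    Prop where
  mul_same : ∀ p q r, ty p = ty q → ty q = ty r → m p q * m q r = m p r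
  mul_of_ne : ∀ p q q' r, q ≠ q' → m p q * m q' r = 0
  eq_zero : ∀ p q, ty p ≠ ty q → m p q = 0
  sum_eq_one : ∑ p, m p p = 1

section Lifting

variable {R S : Type*} [Ring R] [Ring S]

theorem eq_zero_of_isIdempotentElem_of_isNilpotent {g : R} (h : IsIdempotentElem g)
    (hn : IsNilpotent g) : g = 0 := by
  obtain ⟨n, hn⟩ := hn
  rw [← h.pow_succ_eq n, _root_.pow_succ, hn, zero_mul]

/-- Lift `s` and `t` into the corners eRf and fRe. Then y x = f + j with `j` nilpotent, and
multiplying `y` by the inverse of 1 + j makes y x = f exactly. Now x y is an idempotent below `e`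
with the same image, so e - x y is a nilpotent idempotent and vanishes. -/
theorem exists_lift_of_equivalent_idempotents {π : R →+* S} (hπ : Function.Surjective π)
    (hker : ∀ x ∈ RingHom.ker π, IsNilpotent x) {e f : R} (he : IsIdempotentElem e)
    (hf : IsIdempotentElem f) {s t : S} (hs : π e * s = s) (hs' : s * π f = s)
    (ht : π f * t = t) (ht' : t * π e = t) (hst : s * t = π e) (hts : t * s = π f) :
    ∃ x y : R, π x = s ∧ π y = t ∧ x * y = e ∧ y * x = f ∧ e * x = x ∧ y * e = y := by
  obtain ⟨x0, rfl⟩ := hπ s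
  obtain ⟨y0, rfl⟩ := hπ t
  obtain ⟨x, hx⟩ : ∃ x, x = e * x0 * f := ⟨_, rfl⟩
  obtain ⟨y, hy⟩ : ∃ y, y = f * y0 * e := ⟨_, rfl⟩
  have hex : e * x = x := by rw [hx, ← mul_assoc, ← mul_assoc, he.eq]
  have hxf : x * f = x := by rw [hx, mul_assoc, hf.eq]
  have hfy : f * y = y := by rw [hy, ← mul_assoc, ← mul_assoc, hf.eq]
  have hye : y * e = y := by rw [hy, mul_assoc, he.eq]
  have hπx : π x = π x0 := by rw [hx, map_mul, map_mul, hs, hs']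
  have hπy : π y = π y0 := by rw [hy, map_mul, map_mul, ht, ht']
  obtain ⟨j, hj⟩ : ∃ j, j = y * x - f := ⟨_, rfl⟩
  have hπj : π j = 0 := by rw [hj, map_sub, map_mul, hπx, hπy, hts, sub_self]
  have hfj : f * j = j := by rw [hj, mul_sub, ← mul_assoc, hfy, hf.eq]
  have hjf : j * f = j := by rw [hj, sub_mul, mul_assoc, hxf, hf.eq]
  obtain ⟨u, hu⟩ := (hker j hπj).isUnit_one_add
  have hπu : π (↑u⁻¹ : R) = 1 := by
    have : π (u : R) = 1 := by rw [hu, map_add, map_one, hπj, add_zero]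
    rw [← mul_one (π _)]
    conv_lhs => rw [← this]
    rw [← map_mul, Units.inv_mul, map_one]
  have hyx : f * (u : R) = y * x := by rw [hu, mul_add, hfj, mul_one, hj]; abel
  have hcomm : f * (u : R) = u * f := by rw [hu, mul_add, add_mul, hfj, hjf, mul_one, one_mul]
  have hz1 : ↑u⁻¹ * y * x = f := by
    rw [mul_assoc, ← hyx, hcomm, Units.inv_mul_cancel_left]
  refine ⟨x, ↑u⁻¹ * y, hπx, by rw [map_mul, hπu, one_mul, hπy], ?_, hz1, hex, ?_⟩
  · obtain ⟨g, hg⟩ : ∃ g, g = x * (↑u⁻¹ * y) := ⟨_, rfl⟩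
    have hgg : g * g = g := by
      calc g * g = x * (↑u⁻¹ * y * x) * (↑u⁻¹ * y) := by rw [hg]; noncomm_ring
        _ = g := by rw [hz1, hxf, hg]
    have heg : e * g = g := by rw [hg, ← mul_assoc, hex]
    have hge : g * e = g := by rw [hg, mul_assoc, mul_assoc, hye]
    have h0 : e - g = 0 := by
      refine eq_zero_of_isIdempotentElem_of_isNilpotent ?_ (hker _ ?_)
      · rw [IsIdempotentElem, sub_mul, mul_sub, mul_sub, he.eq, heg, hge, hgg]; abel
      · rw [RingHom.mem_ker, map_sub, hg, map_mul, map_mul, hπu, one_mul, hπx, hπy, hst, sub_self]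
    rw [← hg, ← sub_eq_zero.1 h0]
  · rw [mul_assoc, hye]

/-- The diagonal idempotents lift orthogonally; then only the equivalences between each row and one
reference row of its block are lifted, and all other units are products of two of these. This makes
the multiplication rules automatic. -/
theorem IsMatrixUnits.exists_lift {ι κ : Type*} [Fintype ι] {π : R →+* S}
    (hπ : Function.Surjective π) (hker : ∀ x ∈ RingHom.ker π, IsNilpotent x)
    {ty : ι → κ} {m : ι → ι → S} (hm : IsMatrixUnits ty m) :
    ∃ E : ι → ι → R, IsMatrixUnits ty E ∧ ∀ p q, π (E p q) = m p q := by
  classical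
  obtain ⟨e, he, hem⟩ := CompleteOrthogonalIdempotents.lift_of_isNilpotent_ker π hker
    (e := fun p => m p p)
    { idem := fun p => hm.mul_same p p p rfl rfl
      ortho := fun p q hpq => hm.mul_of_ne p p q q hpq
      complete := hm.sum_eq_one } fun p => hπ _
  replace hem : ∀ p, π (e p) = m p p := congrFun hem
  -- `b p` is the reference row of the block of `p`.
  obtain ⟨b, hb, hb'⟩ : ∃ b : ι → ι, (∀ p, ty (b p) = ty p) ∧
      ∀ p q, ty p = ty q → b p = b q :=
    ⟨fun p => Set.rangeSplitting ty ⟨ty p, p, rfl⟩,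
      fun p => Set.apply_rangeSplitting ty _, fun p q h => by simp only [h]⟩
  have key : ∀ p, ∃ x y : R, π x = m p (b p) ∧ π y = m (b p) p ∧ x * y = e p ∧
      y * x = e (b p) ∧ e p * x = x ∧ y * e p = y := fun p =>
    exists_lift_of_equivalent_idempotents hπ hker (he.idem p) (he.idem (b p))
      (by rw [hem, hm.mul_same _ _ _ rfl (hb p).symm])
      (by rw [hem, hm.mul_same _ _ _ (hb p).symm rfl])
      (by rw [hem, hm.mul_same _ _ _ rfl (hb p)])
      (by rw [hem, hm.mul_same _ _ _ (hb p) rfl])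
      (by rw [hem, hm.mul_same _ _ _ (hb p).symm (hb p)])
      (by rw [hem, hm.mul_same _ _ _ (hb p) (hb p).symm])
  choose x y hx hy hxy hyx hex hye using key
  have hyxb : ∀ p, x p * e (b p) = x p := fun p => by
    rw [← hyx, ← mul_assoc, hxy, hex]
  have hyx0 : ∀ q q', q ≠ q' → y q * x q' = 0 := fun q q' h => by
    rw [← hye q, ← hex q', mul_assoc, ← mul_assoc (e q), he.ortho h, zero_mul, mul_zero]
  refine ⟨fun p q => if ty p = ty q then x p * y q else 0, ⟨?_, ?_, ?_, ?_⟩, ?_⟩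
  · intro p q r h1 h2
    simp only [if_pos h1, if_pos h2, if_pos (h1.trans h2)]
    rw [mul_assoc, ← mul_assoc (y q), hyx, ← mul_assoc, ← hb' p q h1, hyxb]
  · intro p q q' r h
    split_ifs
    · rw [mul_assoc, ← mul_assoc (y q), hyx0 q q' h, zero_mul, mul_zero]
    all_goals simp
  · exact fun p q h => if_neg h
  · simp only [if_true, hxy]
    exact he.complete
  · intro p q
    simp only
    split_ifs with h
    · rw [map_mul, hx, hy, hb' p q h, hm.mul_same _ _ _ (h.trans (hb q).symm) (hb q)]
    · rw [map_zero, hm.eq_zero p q h]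

end Lifting

section PiMatrix

variable {F : Type u} [Field F] {n : ℕ} (d : Fin n → ℕ)

/-- The matrix units of a product of matrix algebras. -/
def piMatrixUnit (p q : Σ i, Fin (d i)) : ∀ i, Matrix (Fin (d i)) (Fin (d i)) F :=
  fun i => Matrix.of fun a b => if p = ⟨i, a⟩ ∧ q = ⟨i, b⟩ then 1 else 0

theorem isMatrixUnits_piMatrixUnit :
    IsMatrixUnits (fun p : Σ i, Fin (d i) => (p.1 : ℕ)) (piMatrixUnit (F := F) d) where
  mul_same := by
    rintro ⟨i, a⟩ ⟨j, b⟩ ⟨k, c⟩ h1 h2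
    obtain rfl : i = j := Fin.ext h1
    obtain rfl : i = k := Fin.ext h2
    funext l
    ext s t
    simp only [piMatrixUnit, Pi.mul_apply, Matrix.mul_apply, Matrix.of_apply]
    by_cases hl : i = l
    · subst hl
      rw [Finset.sum_eq_single b]
      · by_cases h : a = s <;> by_cases h' : c = t <;> simp [h, h']
      · intro x _ hx
        rw [if_neg (by simp [Ne.symm hx]), zero_mul]
      · simp
    · rw [if_neg (by simp [hl])]
      exact Finset.sum_eq_zero fun x _ => by rw [if_neg (by simp [hl]), zero_mul]
  mul_of_ne := by
    intro p q q' r h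
    funext l
    ext s t
    simp only [piMatrixUnit, Pi.mul_apply, Matrix.mul_apply, Matrix.of_apply, Pi.zero_apply,
      Matrix.zero_apply]
    refine Finset.sum_eq_zero fun x _ => ?_
    by_cases hq : q = ⟨l, x⟩
    · have hq' : ¬(q' = ⟨l, x⟩ ∧ r = ⟨l, t⟩) := fun h2 => h (hq.trans h2.1.symm)
      rw [if_neg hq', mul_zero]
    · rw [if_neg (fun h2 => hq h2.2), zero_mul]
  eq_zero := by
    intro p q h
    funext l
    ext s t
    simp only [piMatrixUnit, Matrix.of_apply, Pi.zero_apply, Matrix.zero_apply]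
    rw [if_neg]
    rintro ⟨rfl, rfl⟩
    exact h rfl
  sum_eq_one := by
    funext l
    ext s t
    simp only [piMatrixUnit, Finset.sum_apply, Matrix.sum_apply, Matrix.of_apply, Pi.one_apply,
      Matrix.one_apply]
    rw [Finset.sum_eq_single ⟨l, s⟩]
    · simp
    · intro x _ hx
      rw [if_neg fun h => hx h.1]
    · simp

theorem span_piMatrixUnit :
    Submodule.span F (Set.range fun p : (Σ i, Fin (d i)) × (Σ i, Fin (d i)) =>
      piMatrixUnit (F := F) d p.1 p.2) = ⊤ := by
  rw [eq_top_iff]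
  intro x _
  have : x = ∑ i, ∑ a, ∑ b, x i a b • piMatrixUnit d ⟨i, a⟩ ⟨i, b⟩ := by
    funext l
    ext s t
    simp only [Finset.sum_apply, Matrix.sum_apply, Pi.smul_apply, Matrix.smul_apply, piMatrixUnit,
      Matrix.of_apply]
    rw [Finset.sum_eq_single l]
    · rw [Finset.sum_eq_single s]
      · rw [Finset.sum_eq_single t]
        · simp
        · intro y _ hy
          simp [hy]
        · simp
      · intro y _ hy
        simp [hy]
      · simp
    · intro y _ hy
      simp [hy]
    · simp
  rw [this]
  exact Submodule.sum_mem _ fun i _ => Submodule.sum_mem _ fun a _ => Submodule.sum_mem _ fun b _ =>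
    Submodule.smul_mem _ _ (Submodule.subset_span ⟨(⟨i, a⟩, ⟨i, b⟩), rfl⟩)

theorem piMatrixUnit_self_ne_zero (p : Σ i, Fin (d i)) : piMatrixUnit (F := F) d p p ≠ 0 := by
  intro h
  have := congrFun (congrFun (congrFun h p.1) p.2) p.2
  simp [piMatrixUnit] at this

end PiMatrix

/-! ### Wedderburn splitting inside the unitization -/

section Splitting

variable (F : Type u) [Field F] (A : Type v) [NonUnitalRing A] [Module F A]
  [IsScalarTower F A A] [SMulCommClass F A A]

/-- Matrix units of the unitization of `A` that span a complement of the radical. The block of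
`base` is the one-dimensional component that does not belong to `A`. -/
structure Splitting where
  /-- the rows of the matrix units -/
  ι : Type
  [fintype : Fintype ι]
  [decidableEq : DecidableEq ι]
  /-- the block of a row -/
  ty : ι → ℕ
  /-- the row outside `A` -/
  base : ι
  /-- the matrix units -/
  E : ι → ι → Unitization F A
  isMatrixUnits : IsMatrixUnits ty E
  eq_base : ∀ p, ty p = ty base → p = base
  fst_E : ∀ p q, p ≠ base → (E p q).fst = 0
  fst_base : (E base base).fst = 1
  E_ne_zero : ∀ p, E p p ≠ 0
  span_sup : Submodule.span F (Set.range fun p : ι × ι => E p.1 p.2)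
    ⊔ (Ring.jacobson (Unitization F A)).restrictScalars F = ⊤

attribute [instance] Splitting.fintype Splitting.decidableEq

variable {F A} in
theorem exists_algHom_pi_matrix [IsAlgClosed F] [FiniteDimensional F A] :
    ∃ (n : ℕ) (d : Fin n → ℕ) (π : Unitization F A →ₐ[F] ∀ i, Matrix (Fin (d i)) (Fin (d i)) F),
      Function.Surjective π ∧ ∀ x, π x = 0 ↔ x ∈ Ring.jacobson (Unitization F A) := by
  have := finiteDimensional_unitization F A
  have := isArtinianRing_unitization F A
  obtain ⟨n, d, -, ⟨φ⟩⟩ := IsSemisimpleRing.exists_algEquiv_pi_matrix_of_isAlgClosed F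
    (Unitization F A ⧸ Ring.jacobson (Unitization F A))
  refine ⟨n, d, φ.toAlgHom.comp (Ideal.Quotient.mkₐ F (Ring.jacobson (Unitization F A))),
    φ.surjective.comp Ideal.Quotient.mk_surjective, fun x => ?_⟩
  rw [← Ideal.Quotient.eq_zero_iff_mem]
  exact map_eq_zero_iff φ φ.injective

/-- The augmentation is multiplicative to a field, so it is nonzero on at most one of the orthogonal
diagonal idempotents, and on at least one because they sum to 1. That row is the base. A second row
`p` in its block would factor the nonzero augmentation of the base idempotent through that of `E p
p`, which is 0, so the block has size one. -/
theorem nonempty_splitting [IsAlgClosed F] [FiniteDimensional F A] : Nonempty (Splitting F A) := by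
  obtain ⟨n, d, π, hπ, hker⟩ := exists_algHom_pi_matrix (F := F) (A := A)
  obtain ⟨E, hE, hEm⟩ := (isMatrixUnits_piMatrixUnit (F := F) d).exists_lift
    (π := (π : Unitization F A →+* _)) hπ
    fun x hx => isNilpotent_of_mem_jacobson ((hker x).1 (RingHom.mem_ker.1 hx))
  have hεmul : ∀ p q r, ((p : Σ i, Fin (d i)).1 : ℕ) = q.1 → (q.1 : ℕ) = r.1 →
      (E p q).fst * (E q r).fst = (E p r).fst := fun p q r h1 h2 => by
    rw [← hE.mul_same p q r h1 h2, Unitization.fst_mul]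
  obtain ⟨p0, hp0⟩ : ∃ p, (E p p).fst ≠ 0 := by
    by_contra! h
    have h1 := congrArg (Unitization.fstHom F A) hE.sum_eq_one
    rw [map_sum, map_one] at h1
    refine one_ne_zero (h1.symm.trans (Finset.sum_eq_zero fun p _ => h p))
  have h1 : ∀ p, p ≠ p0 → (E p p).fst = 0 := fun p hp => by
    have h2 := congrArg (fun x => x.fst) (hE.mul_of_ne p p p0 p0 hp)
    rw [Unitization.fst_mul, Unitization.fst_zero] at h2
    exact (mul_eq_zero.1 h2).resolve_right hp0
  refine ⟨⟨_, _, p0, E, hE, ?_, ?_, ?_, ?_, ?_⟩⟩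
  · intro p hp
    by_contra h
    refine hp0 ?_
    rw [← hεmul p0 p p0 hp.symm hp, mul_comm, hεmul p p0 p hp hp.symm, h1 p h]
  · intro p q hp
    by_cases hpq : (p.1 : ℕ) = q.1
    · rw [← hεmul p p q rfl hpq, h1 p hp, zero_mul]
    · rw [hE.eq_zero p q hpq, Unitization.fst_zero]
  · exact mul_left_cancel₀ hp0 (by rw [hεmul _ _ _ rfl rfl, mul_one])
  · intro p hp
    refine piMatrixUnit_self_ne_zero (F := F) d p ?_
    rw [← hEm, hp, map_zero]
  · rw [eq_top_iff]
    intro x _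
    have h2 : π x ∈ (Submodule.span F (Set.range fun p : (Σ i, Fin (d i)) × (Σ i, Fin (d i)) =>
        E p.1 p.2)).map π.toLinearMap := by
      rw [Submodule.map_span, ← Set.range_comp]
      have : (π.toLinearMap ∘ fun p : (Σ i, Fin (d i)) × (Σ i, Fin (d i)) => E p.1 p.2)
          = fun p => piMatrixUnit (F := F) d p.1 p.2 := funext fun p => hEm p.1 p.2
      rw [this, span_piMatrixUnit]
      trivial
    obtain ⟨y, hy, hyx⟩ := h2
    refine Submodule.mem_sup.2 ⟨y, hy, x - y, ?_, by abel⟩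
    rw [Submodule.restrictScalars_mem, ← hker, map_sub, sub_eq_zero]
    exact hyx.symm

end Splitting

/-! ### The semisimple part, and deletion of a block -/

section SpanMul

variable {F : Type u} [Field F] {A : Type v} [NonUnitalRing A] [Module F A]
  [IsScalarTower F A A] [SMulCommClass F A A]

theorem span_mul_mem {G : Set A} (hG : ∀ x ∈ G, ∀ y ∈ G, x * y ∈ Submodule.span F G) {x y : A}
    (hx : x ∈ Submodule.span F G) (hy : y ∈ Submodule.span F G) :
    x * y ∈ Submodule.span F G := by
  induction hx using Submodule.span_induction with
  | mem x hx =>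
    induction hy using Submodule.span_induction with
    | mem y hy => exact hG x hx y hy
    | zero => rw [mul_zero]; exact zero_mem _
    | add y z _ _ hy hz => rw [mul_add]; exact add_mem hy hz
    | smul c y _ hy => rw [mul_smul_comm]; exact Submodule.smul_mem _ _ hy
  | zero => rw [zero_mul]; exact zero_mem _
  | add x z _ _ hx hz => rw [add_mul]; exact add_mem hx hz
  | smul c x _ hx => rw [smul_mul_assoc]; exact Submodule.smul_mem _ _ hx

variable [FiniteDimensional F A]

theorem mul_mem_radical_left (x : A) {j : A} (hj : j ∈ radical F A) : x * j ∈ radical F A := by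
  rw [mem_radical_iff] at hj ⊢
  rw [Unitization.inr_mul]
  exact Ideal.mul_mem_left _ _ hj

theorem mul_mem_radical_right (x : A) {j : A} (hj : j ∈ radical F A) : j * x ∈ radical F A := by
  rw [mem_radical_iff] at hj ⊢
  rw [Unitization.inr_mul]
  exact Ideal.mul_mem_right _ _ hj

end SpanMul

namespace Splitting

variable {F : Type u} [Field F] {A : Type v} [NonUnitalRing A] [Module F A]
  [IsScalarTower F A A] [SMulCommClass F A A] (Z : Splitting F A)

/-- The matrix units as elements of `A`, for rows other than `Z.base`. -/
def e (p q : Z.ι) : A := (Z.E p q).snd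

/-- The positions of the matrix units in `A`. -/
abbrev Pos : Type := {c : Z.ι × Z.ι // Z.ty c.1 = Z.ty c.2 ∧ c.1 ≠ Z.base}

/-- The matrix units in `A`. -/
def unit (c : Z.Pos) : A := Z.e c.1.1 c.1.2

theorem inr_e {p : Z.ι} (hp : p ≠ Z.base) (q : Z.ι) :
    ((Z.e p q : A) : Unitization F A) = Z.E p q := by
  conv_rhs => rw [← Unitization.inl_fst_add_inr_snd_eq (Z.E p q), Z.fst_E p q hp,
    Unitization.inl_zero, zero_add]
  rfl

theorem inr_unit (c : Z.Pos) : ((Z.unit c : A) : Unitization F A) = Z.E c.1.1 c.1.2 :=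
  Z.inr_e c.2.2 _

theorem Pos.snd_ne (c : Z.Pos) : c.1.2 ≠ Z.base := fun h =>
  c.2.2 (Z.eq_base _ (by rw [c.2.1, h]))

/-- The semisimple part of `A`, restricted to the blocks in `T`. -/
def ssPart (T : Set ℕ) : Submodule F A :=
  Submodule.span F {x | ∃ c : Z.Pos, Z.ty c.1.1 ∈ T ∧ Z.unit c = x}

/-- The semisimple part of `A`. -/
def ss : Submodule F A := Z.ssPart Set.univ

theorem unit_mem_ss (c : Z.Pos) : Z.unit c ∈ Z.ss := Submodule.subset_span ⟨c, trivial, rfl⟩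

theorem ssPart_mul_mem {T : Set ℕ} {x y : A} (hx : x ∈ Z.ssPart T) (hy : y ∈ Z.ssPart T) :
    x * y ∈ Z.ssPart T := by
  refine span_mul_mem ?_ hx hy
  rintro _ ⟨c, hc, rfl⟩ _ ⟨c', hc', rfl⟩
  by_cases h : c.1.2 = c'.1.1
  · refine Submodule.subset_span
      ⟨⟨(c.1.1, c'.1.2), c.2.1.trans ((congrArg Z.ty h).trans c'.2.1), c.2.2⟩, hc, ?_⟩
    apply Unitization.inr_injective (R := F)
    rw [Unitization.inr_mul, inr_unit, inr_unit, inr_unit]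
    rw [← Z.isMatrixUnits.mul_same c.1.1 c.1.2 c'.1.2 c.2.1 ((congrArg Z.ty h).trans c'.2.1)]
    rw [h]
  · have : Z.unit c * Z.unit c' = 0 := by
      apply Unitization.inr_injective (R := F)
      rw [Unitization.inr_mul, inr_unit, inr_unit, Z.isMatrixUnits.mul_of_ne _ _ _ _ h,
        Unitization.inr_zero]
    rw [this]
    exact zero_mem _

variable [FiniteDimensional F A]

theorem E_self_notMem_jacobson (p : Z.ι) : Z.E p p ∉ Ring.jacobson (Unitization F A) := fun h =>
  Z.E_ne_zero p (eq_zero_of_isIdempotentElem_of_isNilpotent (Z.isMatrixUnits.mul_same p p p rfl rfl)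
    (isNilpotent_of_mem_jacobson h))

theorem ss_sup_radical : Z.ss ⊔ radical F A = ⊤ := by
  rw [eq_top_iff]
  intro a _
  have key : ∀ x ∈ Submodule.span F (Set.range fun p : Z.ι × Z.ι => Z.E p.1 p.2),
      ∃ y ∈ Z.ss, ∃ c : F, x = (y : Unitization F A) + c • Z.E Z.base Z.base := by
    intro x hx
    induction hx using Submodule.span_induction with
    | mem x hx =>
      obtain ⟨⟨p, q⟩, rfl⟩ := hx
      by_cases ht : Z.ty p = Z.ty q
      · by_cases hp : p = Z.base
        · refine ⟨0, zero_mem _, 1, ?_⟩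
          rw [hp] at ht ⊢
          simp only [Z.eq_base q ht.symm]
          simp
        · exact ⟨_, Z.unit_mem_ss ⟨(p, q), ht, hp⟩, 0, by rw [inr_unit]; simp⟩
      · exact ⟨0, zero_mem _, 0, by simp [Z.isMatrixUnits.eq_zero p q ht]⟩
    | zero => exact ⟨0, zero_mem _, 0, by simp⟩
    | add x y _ _ hx hy =>
      obtain ⟨x', hx', c, rfl⟩ := hx
      obtain ⟨y', hy', d, rfl⟩ := hy
      exact ⟨x' + y', add_mem hx' hy', c + d, by rw [Unitization.inr_add, add_smul]; abel⟩
    | smul r x _ hx =>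
      obtain ⟨x', hx', c, rfl⟩ := hx
      exact ⟨r • x', Submodule.smul_mem _ _ hx', r * c, by
        rw [Unitization.inr_smul, mul_smul, smul_add]⟩
  have ha : (a : Unitization F A) ∈ (⊤ : Submodule F (Unitization F A)) := trivial
  rw [← Z.span_sup] at ha
  obtain ⟨x, hx, j, hj, hxj⟩ := Submodule.mem_sup.1 ha
  obtain ⟨y, hy, c, rfl⟩ := key x hx
  obtain ⟨j, rfl⟩ := exists_inr_of_mem_jacobson hj
  -- Compare augmentations: the elements coming from `A` have augmentation 0, the base idempotent
  -- has 1.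
  have hc : c = 0 := by
    have := congrArg (Unitization.fstHom F A) hxj
    simp only [map_add, map_smul, Unitization.fstHom_apply, Unitization.fst_inr, Z.fst_base] at this
    simpa using this
  refine Submodule.mem_sup.2 ⟨y, hy, j, mem_radical_iff.2 hj, ?_⟩
  apply Unitization.inr_injective (R := F)
  rw [← hxj, hc, zero_smul, add_zero, Unitization.inr_add]

/-- Multiplying a relation by `E p p` on the left and `E q p` on the right isolates the coefficient
of `E p q` as a multiple of `E p p`, which is a nonzero idempotent and so not in the nil radical. -/
theorem linearIndependent_unit :
    LinearIndependent F fun c : Z.Pos => (radical F A).mkQ (Z.unit c) := by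
  rw [Fintype.linearIndependent_iff]
  intro g hg c
  simp only [← map_smul, ← map_sum] at hg
  rw [Submodule.mkQ_apply, Submodule.Quotient.mk_eq_zero, mem_radical_iff] at hg
  change Unitization.inrNonUnitalAlgHom F A _ ∈ _ at hg
  rw [map_sum] at hg
  have h1 := Ideal.mul_mem_left _ (Z.E c.1.1 c.1.1) (Ideal.mul_mem_right (Z.E c.1.2 c.1.1) _ hg)
  rw [Finset.sum_mul, Finset.mul_sum, Finset.sum_eq_single c] at h1
  · by_contra hgc
    rw [map_smul] at h1
    change Z.E c.1.1 c.1.1 * (g c • (Z.unit c : Unitization F A) * Z.E c.1.2 c.1.1) ∈ _ at h1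
    rw [inr_unit, smul_mul_assoc, Z.isMatrixUnits.mul_same _ _ _ c.2.1 c.2.1.symm, mul_smul_comm,
      Z.isMatrixUnits.mul_same _ _ _ rfl rfl] at h1
    have h2 := Submodule.smul_of_tower_mem (Ring.jacobson (Unitization F A)) (g c)⁻¹ h1
    rw [smul_smul, inv_mul_cancel₀ hgc, one_smul] at h2
    exact Z.E_self_notMem_jacobson _ h2
  · intro b _ hb
    rw [map_smul]
    change Z.E c.1.1 c.1.1 * (g b • (Z.unit b : Unitization F A) * Z.E c.1.2 c.1.1) = 0
    rw [inr_unit, smul_mul_assoc, mul_smul_comm]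
    by_cases h : c.1.1 = b.1.1
    · have h2 : b.1.2 ≠ c.1.2 := fun h2 => hb (Subtype.ext (Prod.ext h.symm h2))
      rw [Z.isMatrixUnits.mul_of_ne _ _ _ _ h2, mul_zero, smul_zero]
    · rw [← mul_assoc, Z.isMatrixUnits.mul_of_ne _ _ _ _ h, zero_mul, smul_zero]
  · simp

/-- The matrix units form a basis modulo the radical. This turns the number of inserted words per
set into the cardinality `d` of the small sets. -/
theorem card_pos : Fintype.card Z.Pos = semisimpleDim F A := by
  refine (Module.finrank_eq_card_basis (Module.Basis.mk Z.linearIndependent_unit ?_)).symm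
  rw [show (fun c : Z.Pos => (radical F A).mkQ (Z.unit c)) = (radical F A).mkQ ∘ Z.unit from rfl,
    Set.range_comp, ← Submodule.map_span, top_le_iff]
  have h := congrArg (Submodule.map (radical F A).mkQ) Z.ss_sup_radical
  rw [Submodule.map_sup, Submodule.mkQ_map_self, sup_bot_eq, Submodule.map_top,
    Submodule.range_mkQ] at h
  rw [← h]
  congr 2
  ext x
  simp [eq_comm]

theorem finrank_ss_le : Module.finrank F Z.ss ≤ semisimpleDim F A := by
  rw [← Z.card_pos, ss, ssPart]
  have : {x | ∃ c : Z.Pos, Z.ty c.1.1 ∈ Set.univ ∧ Z.unit c = x} = Set.range Z.unit := by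
    ext x; simp
  rw [this]
  exact finrank_range_le_card Z.unit

/-- The subalgebra obtained by deleting the block `t` from the semisimple part. -/
def deleteBlock (t : ℕ) : NonUnitalSubalgebra F A where
  toAddSubmonoid := (Z.ssPart {t}ᶜ ⊔ radical F A).toAddSubmonoid
  smul_mem' c _ hx := (Z.ssPart {t}ᶜ ⊔ radical F A).smul_mem c hx
  mul_mem' := by
    intro a b ha hb
    obtain ⟨x, hx, j, hj, rfl⟩ := Submodule.mem_sup.1 ha
    obtain ⟨y, hy, k, hk, rfl⟩ := Submodule.mem_sup.1 hb
    refine Submodule.mem_sup.2 ⟨x * y, Z.ssPart_mul_mem hx hy, x * k + j * (y + k), ?_, by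
      noncomm_ring⟩
    exact add_mem (mul_mem_radical_left _ hk) (mul_mem_radical_right _ hj)

theorem mem_deleteBlock {t : ℕ} {x : A} :
    x ∈ Z.deleteBlock t ↔ x ∈ Z.ssPart {t}ᶜ ⊔ radical F A := Iff.rfl

theorem unit_mem_deleteBlock {t : ℕ} {c : Z.Pos} (hc : Z.ty c.1.1 ≠ t) :
    Z.unit c ∈ Z.deleteBlock t :=
  Z.mem_deleteBlock.2 (Submodule.mem_sup_left (Submodule.subset_span ⟨c, hc, rfl⟩))

theorem radical_le_deleteBlock {t : ℕ} {x : A} (hx : x ∈ radical F A) : x ∈ Z.deleteBlock t :=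
  Z.mem_deleteBlock.2 (Submodule.mem_sup_right hx)

/-- Left multiplication by `e p p` kills the other blocks, so membership would put this idempotent
into the radical. -/
theorem e_self_notMem_deleteBlock {p : Z.ι} (hp : p ≠ Z.base) :
    Z.e p p ∉ Z.deleteBlock (Z.ty p) := by
  intro h
  obtain ⟨x, hx, j, hj, hxj⟩ := Submodule.mem_sup.1 (Z.mem_deleteBlock.1 h)
  have h0 : ∀ x ∈ Z.ssPart {Z.ty p}ᶜ, Z.e p p * x = 0 := by
    intro x hx
    induction hx using Submodule.span_induction with
    | mem x hx =>
      obtain ⟨c, hc, rfl⟩ := hx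
      apply Unitization.inr_injective (R := F)
      rw [Unitization.inr_mul, inr_unit, Z.inr_e hp, Z.isMatrixUnits.mul_of_ne,
        Unitization.inr_zero]
      rintro rfl
      exact hc rfl
    | zero => rw [mul_zero]
    | add x y _ _ hx hy => rw [mul_add, hx, hy, add_zero]
    | smul c x _ hx => rw [mul_smul_comm, hx, smul_zero]
  have h1 : Z.e p p * j = Z.e p p := by
    have : Z.e p p * Z.e p p = Z.e p p := by
      apply Unitization.inr_injective (R := F)
      rw [Unitization.inr_mul, Z.inr_e hp, Z.isMatrixUnits.mul_same _ _ _ rfl rfl]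
    calc Z.e p p * j = Z.e p p * (x + j) := by rw [mul_add, h0 x hx, zero_add]
      _ = Z.e p p := by rw [hxj, this]
  have h2 := mem_radical_iff.1 (mul_mem_radical_left (Z.e p p) hj)
  rw [h1, Z.inr_e hp] at h2
  exact Z.E_self_notMem_jacobson p h2

end Splitting

/-! ### The truncated algebra and the strict drop of the parameter -/

section Shift

variable {F : Type u} [Field F] {A : Type v} [NonUnitalRing A] [Module F A]
  [IsScalarTower F A A] [SMulCommClass F A A]

/-- The matrix with `a` on the `k`-th superdiagonal, representing `a t ^ k` modulo `t ^ s`. -/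
def shift (s k : ℕ) : A →ₗ[F] Matrix (Fin s) (Fin s) A where
  toFun a := Matrix.of fun i j => if (i : ℕ) + k = j then a else 0
  map_add' a b := by
    ext i j
    simp only [Matrix.of_apply, Matrix.add_apply]
    split_ifs <;> simp
  map_smul' c a := by
    ext i j
    simp only [Matrix.of_apply, Matrix.smul_apply, RingHom.id_apply]
    split_ifs <;> simp

theorem shift_apply (s k : ℕ) (a : A) (i j : Fin s) :
    shift (F := F) s k a i j = if (i : ℕ) + k = j then a else 0 := rfl

theorem shift_mul_shift (s k l : ℕ) (a b : A) :
    shift (F := F) s k a * shift (F := F) s l b = shift (F := F) s (k + l) (a * b) := by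
  ext i j
  simp only [Matrix.mul_apply, shift_apply]
  by_cases h : (i : ℕ) + (k + l) = j
  · rw [if_pos h, Finset.sum_eq_single ⟨i + k, by omega⟩]
    · simp only [if_true]
      rw [if_pos (by omega)]
    · intro m _ hm
      rw [if_neg, zero_mul]
      exact fun h2 => hm (Fin.ext h2.symm)
    · simp
  · rw [if_neg h]
    refine Finset.sum_eq_zero fun m _ => ?_
    split_ifs
    · omega
    all_goals simp

theorem shift_eq_zero {s k : ℕ} (h : s ≤ k) (a : A) : shift (F := F) s k a = 0 := by
  ext i j
  rw [shift_apply, if_neg (by omega)]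
  rfl

theorem eq_zero_of_shift_eq_zero {s k : ℕ} (h : k < s) {a : A} (ha : shift (F := F) s k a = 0) :
    a = 0 := by
  have := congrFun (congrFun ha ⟨0, by omega⟩) ⟨k, h⟩
  rwa [shift_apply, if_pos (by simp)] at this

theorem lift_shift (s : ℕ) (k : ℕ → ℕ) (a : ℕ → A) (w : FreeSemigroup ℕ) :
    FreeSemigroup.lift (fun i => shift (F := F) s (k i) (a i)) w
      = shift (F := F) s ((wordVars w).map k).sum (FreeSemigroup.lift a w) := by
  induction w using FreeSemigroup.recOnMul with
  | ih1 i => rw [FreeSemigroup.lift_of, FreeSemigroup.lift_of]; simp [wordVars, FreeSemigroup.of]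
  | ih2 x y hx hy =>
    rw [map_mul, map_mul, wordVars_mul, Multiset.map_add, Multiset.sum_add, hy,
      ← shift_mul_shift, ← hx]

/-- Every monomial uses each variable of `S` once, so all monomials pick up the same power of t. -/
theorem evalAt_shift {f : NCPoly F} {S : Finset ℕ}
    (hf : ∀ w ∈ f.coeff.support, wordVars w = S.val) (s : ℕ) (k : ℕ → ℕ) (a : ℕ → A) :
    evalAt (fun i => shift (F := F) s (k i) (a i)) f
      = shift (F := F) s (∑ i ∈ S, k i) (evalAt a f) := by
  rw [evalAt_eq_sum, evalAt_eq_sum, map_sum]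
  refine Finset.sum_congr rfl fun w hw => ?_
  rw [lift_shift, map_smul, hf w hw]
  rfl

end Shift

theorem radicalPow_mul_radical {F : Type u} [Field F] {A : Type v} [NonUnitalRing A] [Module F A]
    [IsScalarTower F A A] [SMulCommClass F A A] {k : ℕ} (hk : 1 ≤ k) {x y : A}
    (hx : x ∈ radicalPow F A k) (hy : y ∈ radical F A) : x * y ∈ radicalPow F A (k + 1) := by
  rw [radicalPow_succ hk]
  exact Submodule.subset_span ⟨x, hx, y, hy, rfl⟩

theorem semisimpleDim_add_finrank_radical {F : Type u} [Field F] {A : Type v} [NonUnitalRing A] [Module F A]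
    [IsScalarTower F A A] [SMulCommClass F A A] [FiniteDimensional F A] :
    semisimpleDim F A + Module.finrank F (radical F A) = Module.finrank F A :=
  Submodule.finrank_quotient_add_finrank (radical F A)

namespace Splitting

variable {F : Type u} [Field F] {A : Type v} [NonUnitalRing A] [Module F A]
  [IsScalarTower F A A] [SMulCommClass F A A] [FiniteDimensional F A] (Z : Splitting F A)

/-- The subalgebra keeps the whole radical, as a nilpotent ideal, but has smaller dimension; so d
drops. -/
theorem par_deleteBlock_lt {p : Z.ι} (hp : p ≠ Z.base) :
    par F (Z.deleteBlock (Z.ty p)) < par F A := by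
  obtain ⟨h1, h2⟩ := one_le_radicalIndex_and_radicalPow F A
  set B := Z.deleteBlock (Z.ty p) with hB
  have : FiniteDimensional F B := FiniteDimensional.finiteDimensional_submodule B.toSubmodule
  let N : ℕ → Submodule F B := fun i => (radicalPow F A i).comap B.toSubmodule.subtype
  have hle := par_le_of_filtration (F := F) (A := B) (N := N)
    (fun x hx b => mul_mem_radical_right (F := F) (A := A) (b : A) (j := (x : A)) hx)
    (fun i hi x hx y hy => radicalPow_mul_radical hi (x := (x : A)) hx hy) h1 (by
      simp only [N, h2, eq_bot_iff]
      intro x hx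
      exact Subtype.ext hx)
  refine hle.trans_lt ?_
  rw [par, Prod.Lex.toLex_lt_toLex]
  left
  have e1 : Module.finrank F (N 1) = Module.finrank F (radical F A) :=
    LinearEquiv.finrank_eq (Submodule.comapSubtypeEquivOfLe (p := radical F A)
      (q := B.toSubmodule) fun x hx => Z.radical_le_deleteBlock hx)
  have e2 : Module.finrank F B < Module.finrank F A := by
    refine Submodule.finrank_lt (s := B.toSubmodule) fun h => ?_
    refine Z.e_self_notMem_deleteBlock hp ?_
    have : Z.e p p ∈ B.toSubmodule := by rw [h]; trivial
    exact this
  have e3 := semisimpleDim_add_finrank_radical (F := F) (A := A)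
  have e4 : Module.finrank F (N 1) ≤ Module.finrank F B := Submodule.finrank_le _
  simp only
  omega

/-- The generators of the part of filtration degree at least `i` of the truncated algebra. -/
def truncGen (F : Type u) [Field F] (A : Type v) [NonUnitalRing A] [Module F A]
    [IsScalarTower F A A] [SMulCommClass F A A] (s i : ℕ) : Set (Matrix (Fin s) (Fin s) A) :=
  {x | ∃ k, i ≤ k ∧ ∃ j ∈ radical F A, x = shift (F := F) s k j}

/-- The algebra `ss + J t + J t ^ 2 + ⋯` modulo `t ^ s`. -/
def trunc (s : ℕ) : NonUnitalSubalgebra F (Matrix (Fin s) (Fin s) A) where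
  toAddSubmonoid := (Submodule.span F
    ({x | ∃ a ∈ Z.ss, x = shift (F := F) s 0 a} ∪ truncGen F A s 1)).toAddSubmonoid
  smul_mem' c _ hx := Submodule.smul_mem _ c hx
  mul_mem' := by
    intro a b ha hb
    refine span_mul_mem ?_ ha hb
    rintro _ (⟨x, hx, rfl⟩ | ⟨k, hk, x, hx, rfl⟩) _ (⟨y, hy, rfl⟩ | ⟨l, hl, y, hy, rfl⟩) <;>
      rw [shift_mul_shift] <;> apply Submodule.subset_span
    · exact Or.inl ⟨_, Z.ssPart_mul_mem hx hy, rfl⟩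
    · exact Or.inr ⟨_, by omega, _, mul_mem_radical_left x hy, rfl⟩
    · exact Or.inr ⟨_, by omega, _, mul_mem_radical_right y hx, rfl⟩
    · exact Or.inr ⟨_, by omega, _, mul_mem_radical_right y hx, rfl⟩

theorem mem_trunc {s : ℕ} {x : Matrix (Fin s) (Fin s) A} : x ∈ Z.trunc s ↔
    x ∈ Submodule.span F ({x | ∃ a ∈ Z.ss, x = shift (F := F) s 0 a} ∪ truncGen F A s 1) := Iff.rfl

theorem finiteDimensional_trunc (s : ℕ) : FiniteDimensional F (Z.trunc s) :=
  FiniteDimensional.finiteDimensional_submodule (Z.trunc s).toSubmodule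

/-- The span of J t, J t^2, ... is a nilpotent ideal with quotient of dimension at most d(A), and it
vanishes from degree s = n_A - 1 on, one step earlier than the radical of `A`. -/
theorem par_trunc_lt [Nontrivial A] : par F (Z.trunc (radicalIndex F A - 1)) < par F A := by
  obtain ⟨h1, h2⟩ := one_le_radicalIndex_and_radicalPow F A
  obtain ⟨s, hs⟩ : ∃ s, s = radicalIndex F A - 1 := ⟨_, rfl⟩
  rw [← hs]
  have := Z.finiteDimensional_trunc s
  let M : ℕ → Submodule F (Matrix (Fin s) (Fin s) A) := fun i => Submodule.span F (truncGen F A s i)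
  let N : ℕ → Submodule F (Z.trunc s) := fun i => (M i).comap (Z.trunc s).toSubmodule.subtype
  have hr : ∀ x ∈ M 1, ∀ b ∈ Z.trunc s, x * b ∈ M 1 := by
    intro x hx b hb
    rw [mem_trunc] at hb
    induction hx using Submodule.span_induction with
    | mem x hx =>
      obtain ⟨k, hk, j, hj, rfl⟩ := hx
      induction hb using Submodule.span_induction with
      | mem y hy =>
        obtain ⟨a, ha, rfl⟩ | ⟨l, hl, i, hi, rfl⟩ := hy <;> rw [shift_mul_shift] <;>
          exact Submodule.subset_span ⟨_, by omega, _, mul_mem_radical_right _ hj, rfl⟩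
      | zero => rw [mul_zero]; exact zero_mem _
      | add y z _ _ hy hz => rw [mul_add]; exact add_mem hy hz
      | smul c y _ hy => rw [mul_smul_comm]; exact Submodule.smul_mem _ _ hy
    | zero => rw [zero_mul]; exact zero_mem _
    | add x z _ _ hx hz => rw [add_mul]; exact add_mem hx hz
    | smul c x _ hx => rw [smul_mul_assoc]; exact Submodule.smul_mem _ _ hx
  have hm : ∀ i, ∀ x ∈ M i, ∀ y ∈ M 1, x * y ∈ M (i + 1) := by
    intro i x hx y hy
    induction hx using Submodule.span_induction with
    | mem x hx =>
      obtain ⟨k, hk, j, hj, rfl⟩ := hx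
      induction hy using Submodule.span_induction with
      | mem y hy =>
        obtain ⟨l, hl, i, hi, rfl⟩ := hy
        rw [shift_mul_shift]
        exact Submodule.subset_span ⟨_, by omega, _, mul_mem_radical_right _ hj, rfl⟩
      | zero => rw [mul_zero]; exact zero_mem _
      | add y z _ _ hy hz => rw [mul_add]; exact add_mem hy hz
      | smul c y _ hy => rw [mul_smul_comm]; exact Submodule.smul_mem _ _ hy
    | zero => rw [zero_mul]; exact zero_mem _
    | add x z _ _ hx hz => rw [add_mul]; exact add_mem hx hz
    | smul c x _ hx => rw [smul_mul_assoc]; exact Submodule.smul_mem _ _ hx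
  -- Nilpotency indices start at 1, hence the maximum when `s = 0`.
  have h0 : M (max s 1) = ⊥ := by
    rw [eq_bot_iff]
    refine Submodule.span_le.2 ?_
    rintro _ ⟨k, hk, j, hj, rfl⟩
    exact shift_eq_zero (by omega) j
  have hle := par_le_of_filtration (F := F) (A := Z.trunc s) (N := N)
    (fun x hx b => hr _ hx _ b.2) (fun i _ x hx y hy => hm i _ hx _ hy) (le_max_right s 1) (by
      simp only [N, h0, eq_bot_iff]
      intro x hx
      exact Subtype.ext hx)
  refine hle.trans_lt ?_
  have e1 : Module.finrank F (N 1) = Module.finrank F (M 1) :=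
    LinearEquiv.finrank_eq (Submodule.comapSubtypeEquivOfLe
      (q := (Z.trunc s).toSubmodule) (Submodule.span_mono Set.subset_union_right))
  have e2 : Module.finrank F (Z.trunc s) ≤ semisimpleDim F A + Module.finrank F (M 1) := by
    have h3 : (Z.trunc s).toSubmodule ≤ Z.ss.map (shift s 0) ⊔ M 1 := by
      refine Submodule.span_le.2 ?_
      rintro _ (⟨a, ha, rfl⟩ | hx)
      · exact Submodule.mem_sup_left ⟨a, ha, rfl⟩
      · exact Submodule.mem_sup_right (Submodule.subset_span hx)
    have h4 := Submodule.finrank_mono h3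
    have h5 := Submodule.finrank_add_le_finrank_add_finrank (Z.ss.map (shift (F := F) s 0)) (M 1)
    have h6 := Submodule.finrank_map_le (shift (F := F) s 0) Z.ss
    have h7 := Z.finrank_ss_le
    change Module.finrank F (Z.trunc s).toSubmodule ≤ _
    omega
  rw [par, Prod.Lex.toLex_lt_toLex, ← hs]
  -- If `s = 0`, the second coordinate cannot drop. Then the truncated algebra consists of empty
  -- matrices, while `A` is semisimple and nonzero, so d drops instead.
  rcases Nat.eq_zero_or_pos s with h | h
  · left
    have h3 : radicalIndex F A = 1 := by omega
    rw [h3] at h2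
    have h4 : radical F A = ⊥ := h2
    have h5 := semisimpleDim_add_finrank_radical (F := F) (A := A)
    rw [h4, finrank_bot] at h5
    have h6 : 0 < Module.finrank F A := Module.finrank_pos
    have h7 : Module.finrank F (Z.trunc s) = 0 := by
      subst h
      have : Subsingleton (Z.trunc 0) := ⟨fun x y => Subtype.ext (by ext i; exact i.elim0)⟩
      exact Module.finrank_zero_of_subsingleton
    simp only
    omega
  · rcases Nat.lt_or_ge (Module.finrank F (Z.trunc s) - Module.finrank F (N 1))
      (semisimpleDim F A) with h3 | h3
    · exact Or.inl h3
    · right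
      simp only
      omega

/-- By multilinearity it suffices to evaluate on elements a t^n, where the value is f(a) times a
power of t. -/
theorem identities_subset_trunc [CharZero F] (s : ℕ) :
    identities F A ⊆ identities F (Z.trunc s) := by
  apply identities_subset_of_multilinear
  rintro f ⟨S, hS⟩ hf
  have hspan : Submodule.span F {x : Z.trunc s | (x : Matrix (Fin s) (Fin s) A) ∈
      {x | ∃ a ∈ Z.ss, x = shift (F := F) s 0 a} ∪ truncGen F A s 1} = ⊤ :=
    Submodule.span_span_coe_preimage
  refine evalAt_eq_zero_of_span hS hspan fun r hr => ?_
  have : ∀ k, ∃ n a, k ∈ S → (r k : Matrix (Fin s) (Fin s) A) = shift (F := F) s n a := by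
    intro k
    by_cases hk : k ∈ S
    · obtain ⟨a, ha, h⟩ | ⟨n, hn, a, ha, h⟩ := hr k hk
      · exact ⟨0, a, fun _ => h⟩
      · exact ⟨n, a, fun _ => h⟩
    · exact ⟨0, 0, fun h => absurd h hk⟩
  choose n a hna using this
  apply Subtype.ext
  change NonUnitalSubalgebraClass.subtype (Z.trunc s) (evalAt r f) = 0
  rw [map_evalAt, evalAt_congr (b := fun k => shift (F := F) s (n k) (a k)), evalAt_shift hS, hf,
    map_zero]
  intro w hw i hi
  rw [hS w hw] at hi
  exact hna i hi

open Classical in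
/-- An identity of the truncated algebra vanishes on `A` as soon as fewer than `s` variables take
values outside the semisimple part. -/
theorem evalAt_eq_zero_of_mem_identities_trunc {s : ℕ} {f : NCPoly F} {S : Finset ℕ}
    (hS : ∀ w ∈ f.coeff.support, wordVars w = S.val) (hf : f ∈ identities F (Z.trunc s))
    {b : ℕ → A} (hb : ∀ k ∈ S, b k ∈ Z.ss ∨ b k ∈ radical F A)
    (hc : (S.filter fun k => b k ∉ Z.ss).card < s) : evalAt b f = 0 := by
  -- Attach t to the values outside the semisimple part. The result is f(b) times t to the number of
  -- such values, and this power is not truncated.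
  have : ∀ k, ∃ r : Z.trunc s, k ∈ S →
      (r : Matrix (Fin s) (Fin s) A) = shift (F := F) s (if b k ∉ Z.ss then 1 else 0) (b k) := by
    intro k
    by_cases hk : k ∈ S
    · by_cases h : b k ∈ Z.ss
      · exact ⟨⟨shift (F := F) s 0 (b k), Submodule.subset_span (Or.inl ⟨_, h, rfl⟩)⟩, by simp [h]⟩
      · exact ⟨⟨shift (F := F) s 1 (b k), Submodule.subset_span
          (Or.inr ⟨1, le_rfl, _, (hb k hk).resolve_left h, rfl⟩)⟩, by simp [h]⟩
    · exact ⟨0, fun h => absurd h hk⟩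
  choose r hr using this
  have h1 := congrArg (NonUnitalSubalgebraClass.subtype (Z.trunc s)) (hf r)
  rw [map_evalAt, map_zero, evalAt_congr (b := fun k =>
    shift (F := F) s (if b k ∉ Z.ss then 1 else 0) (b k)), evalAt_shift hS] at h1
  · refine eq_zero_of_shift_eq_zero ?_ h1
    rwa [Finset.sum_boole, Nat.cast_id]
  · intro w hw i hi
    rw [hS w hw] at hi
    exact hr i hi

theorem evalAt_eq_zero_of_mem_identities_deleteBlock {t : ℕ} {f : NCPoly F} {S : Finset ℕ}
    (hS : ∀ w ∈ f.coeff.support, wordVars w = S.val) (hf : f ∈ identities F (Z.deleteBlock t))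
    {b : ℕ → A} (hb : ∀ k ∈ S, b k ∈ Z.deleteBlock t) : evalAt b f = 0 := by
  classical
  have h1 := congrArg (NonUnitalSubalgebraClass.subtype (Z.deleteBlock t))
    (hf fun k => if h : k ∈ S then ⟨b k, hb k h⟩ else 0)
  rw [map_evalAt, map_zero] at h1
  rw [← h1]
  refine evalAt_congr fun w hw i hi => ?_
  rw [hS w hw] at hi
  rw [dif_pos (show i ∈ S from hi)]
  rfl

end Splitting

/-! ### Extracting a polynomial from basicness -/

section Basic

/-- A finite-dimensional algebra. -/
structure FDAlgebra (F : Type u) [Field F] where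
  /-- the underlying type -/
  carrier : Type v
  [ring : NonUnitalRing carrier]
  [module : Module F carrier]
  [isScalarTower : IsScalarTower F carrier carrier]
  [smulCommClass : SMulCommClass F carrier carrier]
  [finiteDimensional : FiniteDimensional F carrier]

attribute [instance] FDAlgebra.ring FDAlgebra.module FDAlgebra.isScalarTower
  FDAlgebra.smulCommClass FDAlgebra.finiteDimensional

variable {F : Type u} [Field F] {A : Type v} [NonUnitalRing A] [Module F A]
  [IsScalarTower F A A] [SMulCommClass F A A]

/-- Otherwise every multilinear common identity of the `B i` holds in `A`; then `A` and the product
of the `B i` have the same identities, contradicting basicness. -/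
theorem IsBasic.exists_multilinear [CharZero F] (hA : IsBasic F A) {κ : Type} [Finite κ]
    [Nonempty κ] (B : κ → FDAlgebra.{u, v} F) (hpar : ∀ i, par F (B i).carrier < par F A)
    (hid : ∀ i, identities F A ⊆ identities F (B i).carrier) :
    ∃ f : NCPoly F, IsMultilinear f ∧ f ∉ identities F A ∧
      ∀ i, f ∈ identities F (B i).carrier := by
  by_contra! h
  obtain ⟨r, ⟨φ⟩⟩ := Finite.exists_equiv_fin κ
  have hr : 1 ≤ r := Fin.pos (φ (Classical.arbitrary κ))
  refine hA ⟨r, hr, fun i => (B (φ.symm i)).carrier, fun i => inferInstance, fun i => inferInstance,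
    fun i => inferInstance, fun i => inferInstance, fun i => inferInstance, fun i => hpar _, ?_⟩
  apply Set.Subset.antisymm
  · intro f hf a
    funext i
    have h1 := hid (φ.symm i) hf fun k => a k i
    have h2 := map_evalAt (F := F) (A := ∀ i, (B (φ.symm i)).carrier)
      (B := (B (φ.symm i)).carrier)
      { toFun := fun x => x i, map_smul' := fun _ _ => rfl, map_zero' := rfl,
        map_add' := fun _ _ => rfl, map_mul' := fun _ _ => rfl } a f
    exact h2.trans h1
  · apply identities_subset_of_multilinear
    intro g hg hgB
    by_contra hgA
    obtain ⟨i, hi⟩ := h g hg hgA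
    classical
    have key : ∀ j, g ∈ identities F (B (φ.symm j)).carrier := by
      intro j a
      -- Values supported in one factor test an identity of the product on that factor alone.
      have h1 := congrFun (hgB fun k => Pi.single j (a k)) j
      have h2 := map_evalAt (F := F) (A := ∀ i, (B (φ.symm i)).carrier)
        (B := (B (φ.symm j)).carrier)
        { toFun := fun x => x j, map_smul' := fun _ _ => rfl, map_zero' := rfl,
          map_add' := fun _ _ => rfl, map_mul' := fun _ _ => rfl }
        (fun k => Pi.single j (a k)) g
      refine Eq.trans ?_ (h2.symm.trans h1)
      exact congrArg (fun c => evalAt c g) (funext fun k => by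
        change a k = (Pi.single j (a k) : ∀ i, (B (φ.symm i)).carrier) j
        rw [Pi.single_eq_same])
    have key' := key (φ i)
    rw [φ.symm_apply_apply] at key'
    exact hi key'

/-- A multilinear polynomial for which every nonzero evaluation of a basic algebra involves all
blocks and at least `n_A - 1` radical elements. -/
theorem IsBasic.exists_full_multilinear [CharZero F] [FiniteDimensional F A] [Nontrivial A]
    (hA : IsBasic F A) (Z : Splitting F A) :
    ∃ f : NCPoly F, IsMultilinear f ∧ f ∉ identities F A ∧
      f ∈ identities F (Z.trunc (radicalIndex F A - 1)) ∧
      ∀ p, p ≠ Z.base → f ∈ identities F (Z.deleteBlock (Z.ty p)) := by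
  have := Z.finiteDimensional_trunc (radicalIndex F A - 1)
  have : ∀ t, FiniteDimensional F (Z.deleteBlock t) := fun t =>
    FiniteDimensional.finiteDimensional_submodule (Z.deleteBlock t).toSubmodule
  obtain ⟨f, hf, hfA, hfB⟩ := hA.exists_multilinear
    -- The truncation keeps the family nonempty even when `A` is nilpotent and has no blocks to
    -- delete.
    (fun o : Option {p // p ≠ Z.base} => match o with
      | none => ⟨Z.trunc (radicalIndex F A - 1)⟩
      | some p => ⟨Z.deleteBlock (Z.ty p)⟩)
    (by
      rintro (_ | p)
      · exact Z.par_trunc_lt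
      · exact Z.par_deleteBlock_lt p.2)
    (by
      rintro (_ | p)
      · exact Z.identities_subset_trunc _
      · intro f hf a
        apply Subtype.ext
        have h := map_evalAt (NonUnitalSubalgebraClass.subtype (Z.deleteBlock (Z.ty p))) a f
        exact h.trans (hf _))
  exact ⟨f, hf, hfA, hfB none, fun p hp => hfB (some ⟨p, hp⟩)⟩

end Basic

/-! ### Substitution of words for variables -/

section Substitution

variable {F : Type u} [Field F]

/-- The substitution of words for the variables. -/
noncomputable def substWords (φ : ℕ → FreeSemigroup ℕ) : NCPoly F →ₙₐ[F] NCPoly F :=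
  evalAt fun i => MonoidAlgebra.single (φ i) 1

theorem rename_eq_substWords (π : ℕ → ℕ) :
    rename (F := F) π = substWords fun i => FreeSemigroup.of (π i) := rfl

theorem lift_single (φ : ℕ → FreeSemigroup ℕ) (w : FreeSemigroup ℕ) :
    FreeSemigroup.lift (fun i => (MonoidAlgebra.single (φ i) 1 : NCPoly F)) w
      = MonoidAlgebra.single (FreeSemigroup.lift φ w) 1 := by
  induction w using FreeSemigroup.recOnMul with
  | ih1 i => rfl
  | ih2 x y hx hy =>
    rw [map_mul, map_mul, hy]
    change FreeSemigroup.lift _ (FreeSemigroup.of x) * _ = _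
    rw [FreeSemigroup.lift_of, MonoidAlgebra.single_mul_single, one_mul]
    rfl

theorem exists_of_mem_support_substWords {φ : ℕ → FreeSemigroup ℕ} {f : NCPoly F}
    {w : FreeSemigroup ℕ} (hw : w ∈ (substWords φ f).coeff.support) :
    ∃ z ∈ f.coeff.support, FreeSemigroup.lift φ z = w := by
  classical
  rw [substWords, evalAt_eq_sum, MonoidAlgebra.coeff_sum] at hw
  obtain ⟨z, hz, hzw⟩ := Finset.mem_biUnion.1 (Finsupp.support_finsetSum hw)
  rw [lift_single, MonoidAlgebra.smul_single] at hzw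
  refine ⟨z, hz, ?_⟩
  exact (Finset.mem_singleton.1 (Finsupp.support_single_subset hzw)).symm

theorem wordVars_lift (φ : ℕ → FreeSemigroup ℕ) (w : FreeSemigroup ℕ) :
    wordVars (FreeSemigroup.lift φ w) = (wordVars w).bind fun i => wordVars (φ i) := by
  rw [← coe_letters, letters_lift]
  exact (Multiset.coe_bind (letters w) fun i => letters (φ i)).symm

variable {A : Type v} [NonUnitalRing A] [Module F A] [IsScalarTower F A A] [SMulCommClass F A A]

theorem evalAt_substWords (φ : ℕ → FreeSemigroup ℕ) (a : ℕ → A) (f : NCPoly F) :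
    evalAt a (substWords φ f) = evalAt (fun i => FreeSemigroup.lift a (φ i)) f := by
  rw [substWords, map_evalAt]
  simp only [evalAt_single, one_smul]

theorem evalAt_rename (π : ℕ → ℕ) (a : ℕ → A) (f : NCPoly F) :
    evalAt a (rename π f) = evalAt (fun i => a (π i)) f := by
  rw [rename_eq_substWords, evalAt_substWords]
  simp only [FreeSemigroup.lift_of]

theorem rename_rename (π τ : ℕ → ℕ) (f : NCPoly F) :
    rename π (rename τ f) = rename (fun i => π (τ i)) f := by
  conv_lhs => rw [rename]
  rw [evalAt_rename]
  rfl

end Substitution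

/-! ### Alternation over disjoint sets of variables -/

section Alternation

variable {F : Type u} [Field F]

/-- The alternating sum over the permutations of `T`. -/
noncomputable def altOn (T : Finset ℕ) (f : NCPoly F) : NCPoly F :=
  ∑ σ : Equiv.Perm T, ((Equiv.Perm.sign σ : ℤˣ) : ℤ) • rename (⇑(Equiv.Perm.ofSubtype σ)) f

theorem ofSubtype_mem {T : Finset ℕ} (σ : Equiv.Perm T) {i : ℕ} :
    Equiv.Perm.ofSubtype σ i ∈ T ↔ i ∈ T :=
  Equiv.Perm.ofSubtype_apply_mem_iff_mem σ i

theorem ofSubtype_eq {T : Finset ℕ} (σ : Equiv.Perm T) {i : ℕ} (hi : i ∉ T) :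
    Equiv.Perm.ofSubtype σ i = i :=
  Equiv.Perm.ofSubtype_apply_of_not_mem σ hi

/-- Permutations with disjoint supports commute. Hence any set of a disjoint list can be alternated
last, so the result is alternating on each of them. -/
theorem altOn_comm {T T' : Finset ℕ} (h : Disjoint T T') (f : NCPoly F) :
    altOn T (altOn T' f) = altOn T' (altOn T f) := by
  simp only [altOn, map_sum, Finset.smul_sum, map_zsmul]
  rw [Finset.sum_comm]
  refine Finset.sum_congr rfl fun σ _ => Finset.sum_congr rfl fun τ _ => ?_
  rw [smul_comm, rename_rename, rename_rename]
  congr 3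
  refine congrArg rename (funext fun i => ?_)
  by_cases hi : i ∈ T
  · have hi' : i ∉ T' := Finset.disjoint_left.1 h hi
    rw [ofSubtype_eq σ hi', ofSubtype_eq σ (Finset.disjoint_left.1 h ((ofSubtype_mem τ).2 hi))]
  · rw [ofSubtype_eq τ hi]
    by_cases hi' : i ∈ T'
    · rw [ofSubtype_eq τ (Finset.disjoint_right.1 h ((ofSubtype_mem σ).2 hi'))]
    · rw [ofSubtype_eq σ hi', ofSubtype_eq τ hi]

theorem wordVars_altOn {T V : Finset ℕ} (hT : T ⊆ V) {f : NCPoly F}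
    (hf : ∀ w ∈ f.coeff.support, wordVars w = V.val) :
    ∀ w ∈ (altOn T f).coeff.support, wordVars w = V.val := by
  classical
  intro w hw
  rw [altOn, MonoidAlgebra.coeff_sum] at hw
  obtain ⟨σ, -, hσ⟩ := Finset.mem_biUnion.1 (Finsupp.support_finsetSum hw)
  rw [MonoidAlgebra.coeff_smul] at hσ
  obtain ⟨z, hz, rfl⟩ := exists_of_mem_support_substWords (Finsupp.support_smul hσ)
  rw [wordVars_lift, hf z hz]
  have h1 : (V.val.bind fun i => wordVars (FreeSemigroup.of (Equiv.Perm.ofSubtype σ i)))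
      = V.val.map (Equiv.Perm.ofSubtype σ) := Multiset.bind_singleton _ _
  have h2 : V.map (Equiv.Perm.ofSubtype σ).toEmbedding = V := by
    refine Finset.eq_of_subset_of_card_le (fun i hi => ?_) (by rw [Finset.card_map])
    obtain ⟨j, hj, rfl⟩ := Finset.mem_map.1 hi
    by_cases hjT : j ∈ T
    · exact hT ((ofSubtype_mem σ).2 hjT)
    · change Equiv.Perm.ofSubtype σ j ∈ V
      rwa [ofSubtype_eq σ hjT]
  rw [h1]
  exact congrArg Finset.val h2

/-- The alternating sum over the permutations of each of the sets in a list. -/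
noncomputable def altList (l : List (Finset ℕ)) (f : NCPoly F) : NCPoly F := l.foldr altOn f

theorem wordVars_altList {l : List (Finset ℕ)} {V : Finset ℕ} (hl : ∀ T ∈ l, T ⊆ V)
    {f : NCPoly F} (hf : ∀ w ∈ f.coeff.support, wordVars w = V.val) :
    ∀ w ∈ (altList l f).coeff.support, wordVars w = V.val := by
  induction l with
  | nil => exact hf
  | cons T l ih =>
    exact wordVars_altOn (hl T (by simp)) (ih fun T hT => hl T (by simp [hT]))

theorem exists_altList_eq_altOn {l : List (Finset ℕ)} (hl : l.Pairwise Disjoint) {V : Finset ℕ}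
    (hlV : ∀ T ∈ l, T ⊆ V) {f : NCPoly F} (hf : ∀ w ∈ f.coeff.support, wordVars w = V.val)
    {T : Finset ℕ} (hT : T ∈ l) : ∃ h : NCPoly F,
      (∀ w ∈ h.coeff.support, wordVars w = V.val) ∧ altList l f = altOn T h := by
  induction l with
  | nil => simp at hT
  | cons T' l ih =>
    have hlV' : ∀ T ∈ l, T ⊆ V := fun T hT => hlV T (by simp [hT])
    rw [List.pairwise_cons] at hl
    rcases List.mem_cons.1 hT with rfl | hT
    · exact ⟨altList l f, wordVars_altList hlV' hf, rfl⟩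
    · obtain ⟨h, hh, heq⟩ := ih hl.2 hlV' hT
      refine ⟨altOn T' h, wordVars_altOn (hlV T' (by simp)) hh, ?_⟩
      rw [← altOn_comm (hl.1 T hT), ← heq]
      rfl

theorem isMultilinearOn_of_wordVars {V T : Finset ℕ} (hT : T ⊆ V) {f : NCPoly F}
    (hf : ∀ w ∈ f.coeff.support, wordVars w = V.val) : IsMultilinearOn f T :=
  fun w hw _ hi => count_eq_one_of_wordVars (hf w hw) (hT hi)

theorem isAlternatingOn_altList {l : List (Finset ℕ)} (hl : l.Pairwise Disjoint) {V : Finset ℕ}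
    (hlV : ∀ T ∈ l, T ⊆ V) {f : NCPoly F} (hf : ∀ w ∈ f.coeff.support, wordVars w = V.val)
    {T : Finset ℕ} (hT : T ∈ l) : IsAlternatingOn (altList l f) T := by
  obtain ⟨h, hh, heq⟩ := exists_altList_eq_altOn hl hlV hf hT
  exact ⟨isMultilinearOn_of_wordVars (hlV T hT) (wordVars_altList hlV hf), h,
    isMultilinearOn_of_wordVars (hlV T hT) hh, heq⟩

/-- `π` preserves each of the sets in `l` and fixes all other points. -/
def Stabilizes (l : List (Finset ℕ)) (π : Equiv.Perm ℕ) : Prop :=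
  (∀ T ∈ l, ∀ i, π i ∈ T ↔ i ∈ T) ∧ ∀ i, (∀ T ∈ l, i ∉ T) → π i = i

theorem Stabilizes.ofSubtype_mul {T : Finset ℕ} {l : List (Finset ℕ)}
    (hl : (T :: l).Pairwise Disjoint) (σ : Equiv.Perm T) {π : Equiv.Perm ℕ}
    (hπ : Stabilizes l π) : Stabilizes (T :: l) (Equiv.Perm.ofSubtype σ * π) := by
  rw [List.pairwise_cons] at hl
  have hT : ∀ i ∈ T, π i = i := fun i hi =>
    hπ.2 i fun T' hT' => Finset.disjoint_left.1 (hl.1 T' hT') hi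
  have hT' : ∀ i, π i ∈ T ↔ i ∈ T := fun i =>
    ⟨fun h => by rwa [← π.injective (hT _ h)], fun h => by rwa [hT i h]⟩
  constructor
  · intro T₁ hT₁ i
    rw [Equiv.Perm.mul_apply]
    rcases List.mem_cons.1 hT₁ with rfl | h
    · rw [ofSubtype_mem, hT']
    · rw [← hπ.1 T₁ h i]
      by_cases hi : π i ∈ T
      · exact iff_of_false (Finset.disjoint_left.1 (hl.1 T₁ h) ((ofSubtype_mem σ).2 hi))
          (Finset.disjoint_left.1 (hl.1 T₁ h) hi)
      · rw [ofSubtype_eq σ hi]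
  · intro i hi
    rw [Equiv.Perm.mul_apply, hπ.2 i fun T' h => hi T' (by simp [h]),
      ofSubtype_eq σ (hi T (by simp))]

variable {A : Type v} [NonUnitalRing A] [Module F A] [IsScalarTower F A A] [SMulCommClass F A A]

theorem evalAt_altOn (T : Finset ℕ) (f : NCPoly F) (b : ℕ → A) :
    evalAt b (altOn T f) = ∑ σ : Equiv.Perm T, ((Equiv.Perm.sign σ : ℤˣ) : ℤ) •
      evalAt (fun i => b (Equiv.Perm.ofSubtype σ i)) f := by
  simp only [altOn, map_sum, map_zsmul, evalAt_rename]

theorem evalAt_altList_eq_zero {l : List (Finset ℕ)} (hl : l.Pairwise Disjoint) {f : NCPoly F}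
    {b : ℕ → A} (h : ∀ π, Stabilizes l π → evalAt (fun i => b (π i)) f = 0) :
    evalAt b (altList l f) = 0 := by
  induction l generalizing b with
  | nil => exact h 1 ⟨by simp, by simp⟩
  | cons T l ih =>
    change evalAt b (altOn T (altList l f)) = 0
    rw [evalAt_altOn]
    refine Finset.sum_eq_zero fun σ _ => ?_
    rw [ih (List.pairwise_cons.1 hl).2 fun π hπ => by
      simpa only [Equiv.Perm.mul_apply] using
        h (Equiv.Perm.ofSubtype σ * π) (hπ.ofSubtype_mul hl σ), smul_zero]

/-- The iterated alternation is a signed sum over permutations stabilizing every set, and by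
assumption only the identity contributes. -/
theorem evalAt_altList {l : List (Finset ℕ)} (hl : l.Pairwise Disjoint) {f : NCPoly F}
    {b : ℕ → A} (h : ∀ π, Stabilizes l π → π ≠ 1 → evalAt (fun i => b (π i)) f = 0) :
    evalAt b (altList l f) = evalAt b f := by
  induction l with
  | nil => rfl
  | cons T l ih =>
    change evalAt b (altOn T (altList l f)) = _
    have hl' := (List.pairwise_cons.1 hl).2
    rw [evalAt_altOn, Finset.sum_eq_single 1]
    · simp only [map_one, Equiv.Perm.coe_one, id_eq, Units.val_one, one_smul]
      refine ih hl' fun π hπ => h π ?_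
      simpa using hπ.ofSubtype_mul hl 1
    · intro σ _ hσ
      rw [evalAt_altList_eq_zero hl' fun π hπ => ?_, smul_zero]
      have h3 := h (Equiv.Perm.ofSubtype σ * π) (hπ.ofSubtype_mul hl σ)
      simp only [Equiv.Perm.mul_apply] at h3
      refine h3 fun h1 => hσ (Equiv.ext fun i => Subtype.ext ?_)
      have h2 := congrArg (fun τ : Equiv.Perm ℕ => τ i) h1
      simp only [Equiv.Perm.mul_apply, Equiv.Perm.coe_one, id_eq] at h2
      rw [hπ.2 i fun T' hT' => Finset.disjoint_left.1 ((List.pairwise_cons.1 hl).1 T' hT') i.2,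
        Equiv.Perm.ofSubtype_apply_coe] at h2
      exact h2
    · simp

end Alternation

/-! ### Inserting words and alternating them -/

/-- A nonzero evaluation `a` of a multilinear polynomial `f` together with the data needed for
inserting alternating sets: next to the variable `host c` one may insert words `y z y'` with values
`u c`, `b c`, `v c`. The variables `w i` take values in the radical. -/
structure Insertion {F : Type u} [Field F] {A : Type v} [NonUnitalRing A] [Module F A]
    [IsScalarTower F A A] [SMulCommClass F A A] (f : NCPoly F) (S : Finset ℕ) (D : Type) (s : ℕ)
    where
  wordVars_eq : ∀ w ∈ f.coeff.support, wordVars w = S.val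
  a : ℕ → A
  evalAt_ne : evalAt a f ≠ 0
  b : D → A
  u : D → A
  v : D → A
  host : D → ℕ
  left : D → Bool
  w : Fin s → ℕ
  host_mem : ∀ c, host c ∈ S
  w_mem : ∀ i, w i ∈ S
  w_injective : Function.Injective w
  w_radical : ∀ i, a (w i) ∈ radical F A
  mul_left : ∀ c, left c = true → u c * b c * v c * a (host c) = a (host c)
  mul_right : ∀ c, left c = false → a (host c) * (u c * b c * v c) = a (host c)
  mul_ne : ∀ c c', c ≠ c' → u c * b c' * v c = 0
  mul_w : ∀ i, (∃ c, host c = w i) → ∀ c, u c * a (w i) * v c = 0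
  -- Hosts that are radical variables may take any radical value, since their substituted words
  -- change under permutations; hosts that are not radical variables are unrestricted. The
  -- polynomial must vanish once a radical variable that is not a host receives a matrix unit.
  vanish : ∀ a' : ℕ → A, (∀ k ∈ S, (∀ i, w i ≠ k) → (∀ c, host c ≠ k) → a' k = a k) →
    (∀ i, (∃ c, host c = w i) → a' (w i) ∈ radical F A) →
    (∀ i, (∀ c, host c ≠ w i) → a' (w i) = a (w i) ∨ a' (w i) ∈ Set.range b) →
    (∃ i, (∀ c, host c ≠ w i) ∧ a' (w i) ∈ Set.range b) → evalAt a' f = 0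

namespace Insertion

variable {F : Type u} [Field F] {A : Type v} [NonUnitalRing A] [Module F A]
  [IsScalarTower F A A] [SMulCommClass F A A] {f : NCPoly F} {S : Finset ℕ} {D : Type} {s : ℕ}
  [Fintype D] (I : Insertion (A := A) f S D s) (ν : ℕ)

/-- The variables of the extended polynomial: the old ones and three for every inserted word. -/
abbrev Var (D : Type) (s ν : ℕ) : Type := ℕ ⊕ ((Fin ν ⊕ Fin s) × D × Fin 3)

/-- An inserted word. -/
def tri (x : (Fin ν ⊕ Fin s) × D) : List (Var D s ν) :=
  [Sum.inr (x.1, x.2, 0), Sum.inr (x.1, x.2, 1), Sum.inr (x.1, x.2, 2)]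

/-- The words inserted next to the variable `k` on the given side. -/
noncomputable def block (k : ℕ) (β : Bool) : List (Var D s ν) :=
  ((Finset.univ : Finset ((Fin ν ⊕ Fin s) × D)).toList.filter
    fun x => I.host x.2 = k ∧ I.left x.2 = β).flatMap (tri ν)

theorem mem_block {k : ℕ} {β : Bool} {x : Var D s ν} : x ∈ I.block ν k β ↔
    ∃ r c i, I.host c = k ∧ I.left c = β ∧ x = Sum.inr (r, c, i) := by
  simp only [block, List.mem_flatMap, List.mem_filter, Finset.mem_toList, Finset.mem_univ,
    true_and, decide_eq_true_eq, tri, List.mem_cons, List.not_mem_nil, or_false]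
  constructor
  · rintro ⟨⟨r, c⟩, ⟨h1, h2⟩, h | h | h⟩ <;> exact ⟨r, c, _, h1, h2, h⟩
  · rintro ⟨r, c, i, h1, h2, rfl⟩
    refine ⟨(r, c), ⟨h1, h2⟩, ?_⟩
    fin_cases i <;> simp

theorem nodup_block (k : ℕ) (β : Bool) : (I.block ν k β).Nodup := by
  rw [block, List.nodup_flatMap]
  constructor
  · intro x _
    simp [tri]
  · refine List.Pairwise.imp ?_ ((Finset.nodup_toList _).filter _)
    intro x y hxy z hzx hzy
    simp only [tri, List.mem_cons, List.not_mem_nil, or_false] at hzx hzy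
    apply hxy
    obtain rfl | rfl | rfl := hzx <;> obtain h | h | h := hzy <;>
      simp only [Sum.inr.injEq, Prod.mk.injEq] at h <;> exact Prod.ext h.1 h.2.1

/-- The word substituted for the variable `k`. -/
noncomputable def word (k : ℕ) : List (Var D s ν) :=
  I.block ν k true ++ Sum.inl k :: I.block ν k false

theorem mem_word {k : ℕ} {x : Var D s ν} : x ∈ I.word ν k ↔
    x = Sum.inl k ∨ ∃ r c i, I.host c = k ∧ x = Sum.inr (r, c, i) := by
  simp only [word, List.mem_append, List.mem_cons, mem_block]
  constructor
  · rintro (⟨r, c, i, h1, -, h2⟩ | h | ⟨r, c, i, h1, -, h2⟩)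
    · exact Or.inr ⟨r, c, i, h1, h2⟩
    · exact Or.inl h
    · exact Or.inr ⟨r, c, i, h1, h2⟩
  · rintro (h | ⟨r, c, i, h1, h2⟩)
    · exact Or.inr (Or.inl h)
    · cases h3 : I.left c
      · exact Or.inr (Or.inr ⟨r, c, i, h1, h3, h2⟩)
      · exact Or.inl ⟨r, c, i, h1, h3, h2⟩

theorem nodup_word (k : ℕ) : (I.word ν k).Nodup := by
  rw [word, List.nodup_append, List.nodup_cons]
  refine ⟨I.nodup_block ν k true, ⟨?_, I.nodup_block ν k false⟩, ?_⟩
  · rw [mem_block]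
    rintro ⟨r, c, i, -, -, h⟩
    cases h
  · intro x hx y hy
    rw [mem_block] at hx
    obtain ⟨r, c, i, -, h2, rfl⟩ := hx
    rintro rfl
    rcases List.mem_cons.1 hy with h | h
    · cases h
    · rw [mem_block] at h
      obtain ⟨r', c', i', -, h3, h4⟩ := h
      simp only [Sum.inr.injEq, Prod.mk.injEq] at h4
      rw [h4.2.1, h3] at h2
      cases h2

theorem eq_of_mem_word {k l : ℕ} {x : Var D s ν} (hk : x ∈ I.word ν k) (hl : x ∈ I.word ν l) :
    k = l := by
  rw [mem_word] at hk hl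
  rcases hk with rfl | ⟨r, c, i, rfl, rfl⟩
  · rcases hl with h | ⟨r, c, i, -, h⟩
    · exact Sum.inl.inj h
    · cases h
  · rcases hl with h | ⟨r', c', i', rfl, h⟩
    · cases h
    · simp only [Sum.inr.injEq, Prod.mk.injEq] at h
      rw [h.2.1]

/-- The value of a variable. -/
def val : Var D s ν → A
  | Sum.inl k => I.a k
  | Sum.inr (_, c, 0) => I.u c
  | Sum.inr (_, c, 1) => I.b c
  | Sum.inr (_, c, 2) => I.v c

theorem prod_map_block (k : ℕ) (β : Bool) (g : Var D s ν → Unitization F A) :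
    ((I.block ν k β).map g).prod = (((Finset.univ : Finset ((Fin ν ⊕ Fin s) × D)).toList.filter
      fun x => I.host x.2 = k ∧ I.left x.2 = β).map fun x =>
        g (Sum.inr (x.1, x.2, 0)) * g (Sum.inr (x.1, x.2, 1)) * g (Sum.inr (x.1, x.2, 2))).prod := by
  rw [block]
  generalize (List.filter _ _ : List ((Fin ν ⊕ Fin s) × D)) = l
  induction l with
  | nil => rfl
  | cons x l ih =>
    rw [List.flatMap_cons, List.map_append, List.prod_append, ih, List.map_cons, List.prod_cons]
    simp [tri, mul_assoc]

theorem prod_map_word_eq_zero {r : Fin ν ⊕ Fin s} {c : D} {g : Var D s ν → Unitization F A}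
    (h : g (Sum.inr (r, c, 0)) * g (Sum.inr (r, c, 1)) * g (Sum.inr (r, c, 2)) = 0) :
    ((I.word ν (I.host c)).map g).prod = 0 := by
  rw [word, List.map_append, List.prod_append, List.map_cons, List.prod_cons, prod_map_block,
    prod_map_block]
  have hz : ∀ β, I.left c = β → (0 : Unitization F A) ∈
      (((Finset.univ : Finset ((Fin ν ⊕ Fin s) × D)).toList.filter
      fun x => I.host x.2 = I.host c ∧ I.left x.2 = β).map fun x =>
        g (Sum.inr (x.1, x.2, 0)) * g (Sum.inr (x.1, x.2, 1)) * g (Sum.inr (x.1, x.2, 2))) :=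
    fun β hβ => List.mem_map.2 ⟨(r, c), by simp [hβ], h⟩
  cases hc : I.left c
  · rw [List.prod_eq_zero (hz _ hc), mul_zero, mul_zero]
  · rw [List.prod_eq_zero (hz _ hc), zero_mul]

/-- Each inserted triple is absorbed by the value of its host, on the side where it stands. -/
theorem prod_map_word_val (k : ℕ) :
    ((I.word ν k).map fun x => (I.val ν x : Unitization F A)).prod = I.a k := by
  rw [word, List.map_append, List.prod_append, List.map_cons, List.prod_cons, prod_map_block,
    prod_map_block]
  have h1 : ∀ l : List ((Fin ν ⊕ Fin s) × D), (∀ x ∈ l, I.host x.2 = k ∧ I.left x.2 = true) →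
      (l.map fun x => (I.val ν (Sum.inr (x.1, x.2, 0)) : Unitization F A) *
        I.val ν (Sum.inr (x.1, x.2, 1)) * I.val ν (Sum.inr (x.1, x.2, 2))).prod * I.a k
        = I.a k := by
    intro l hl
    induction l with
    | nil => simp
    | cons x l ih =>
      rw [List.map_cons, List.prod_cons, mul_assoc, ih fun y hy => hl y (by simp [hy])]
      obtain ⟨rfl, h3⟩ := hl x (by simp)
      have := I.mul_left x.2 h3
      simp only [val]
      rw [← Unitization.inr_mul, ← Unitization.inr_mul, ← Unitization.inr_mul, this]
  have h2 : ∀ l : List ((Fin ν ⊕ Fin s) × D), (∀ x ∈ l, I.host x.2 = k ∧ I.left x.2 = false) →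
      (I.a k : Unitization F A) * (l.map fun x => (I.val ν (Sum.inr (x.1, x.2, 0)) : Unitization F A) *
        I.val ν (Sum.inr (x.1, x.2, 1)) * I.val ν (Sum.inr (x.1, x.2, 2))).prod
        = I.a k := by
    intro l hl
    induction l with
    | nil => simp
    | cons x l ih =>
      rw [List.map_cons, List.prod_cons, ← mul_assoc]
      have h4 := ih fun y hy => hl y (by simp [hy])
      obtain ⟨rfl, h3⟩ := hl x (by simp)
      have := I.mul_right x.2 h3
      rw [show (I.a (I.host x.2) : Unitization F A) * (I.val ν (Sum.inr (x.1, x.2, 0)) *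
        I.val ν (Sum.inr (x.1, x.2, 1)) * I.val ν (Sum.inr (x.1, x.2, 2))) = I.a (I.host x.2) by
          simp only [val]
          rw [← Unitization.inr_mul, ← Unitization.inr_mul, ← Unitization.inr_mul, this]]
      exact h4
  change _ * ((I.a k : Unitization F A) * _) = _
  rw [h2 _ fun x hx => by simpa using (List.mem_filter.1 hx).2,
    h1 _ fun x hx => by simpa using (List.mem_filter.1 hx).2]

variable {ν} (e : Var D s ν ↪ ℕ)

theorem exists_word (k : ℕ) : ∃ z : FreeSemigroup ℕ, letters z = (I.word ν k).map e := by
  have : (I.word ν k).map e ≠ [] := by simp [word]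
  exact ⟨⟨((I.word ν k).map e).head this, ((I.word ν k).map e).tail⟩, List.cons_head_tail this⟩

/-- The substitution that inserts the new words. -/
noncomputable def φ (k : ℕ) : FreeSemigroup ℕ := (I.exists_word e k).choose

theorem letters_φ (k : ℕ) : letters (I.φ e k) = (I.word ν k).map e := (I.exists_word e k).choose_spec

/-- The sets of variables that will be alternated. -/
def altSet : Fin ν ⊕ Fin s → Finset ℕ
  | Sum.inl r => Finset.univ.image fun c : D => e (Sum.inr (Sum.inl r, c, 1))
  | Sum.inr r => insert (e (Sum.inl (I.w r)))
      (Finset.univ.image fun c : D => e (Sum.inr (Sum.inr r, c, 1)))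

theorem mem_altSet {r : Fin ν ⊕ Fin s} {j : ℕ} : j ∈ I.altSet e r ↔
    (∃ c, e (Sum.inr (r, c, 1)) = j) ∨ ∃ i, r = Sum.inr i ∧ e (Sum.inl (I.w i)) = j := by
  rcases r with r | r
  · simp [altSet]
  · simp [altSet, or_comm, eq_comm]

theorem disjoint_altSet {r r' : Fin ν ⊕ Fin s} (h : r ≠ r') :
    Disjoint (I.altSet e r) (I.altSet e r') := by
  rw [Finset.disjoint_left]
  intro j hj hj'
  rw [mem_altSet] at hj hj'
  rcases hj with ⟨c, rfl⟩ | ⟨i, rfl, rfl⟩ <;> rcases hj' with ⟨c', h'⟩ | ⟨i', rfl, h'⟩ <;>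
    have h' := e.injective h' <;> simp only [reduceCtorEq, Sum.inr.injEq, Sum.inl.injEq,
      Prod.mk.injEq] at h'
  · exact h h'.1.symm
  · exact h (by rw [I.w_injective h'])

theorem card_altSet_inl (r : Fin ν) : (I.altSet e (Sum.inl r)).card = Fintype.card D := by
  rw [altSet, Finset.card_image_of_injective, Finset.card_univ]
  intro c c' h
  simpa using h

theorem card_altSet_inr (r : Fin s) : (I.altSet e (Sum.inr r)).card = Fintype.card D + 1 := by
  rw [altSet, Finset.card_insert_of_notMem, Finset.card_image_of_injective, Finset.card_univ]
  · intro c c' h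
    simpa using h
  · simp

theorem nodup_bind_φ : (S.val.bind fun k => wordVars (I.φ e k)).Nodup := by
  simp only [← coe_letters, letters_φ]
  rw [Multiset.nodup_bind]
  constructor
  · intro k _
    rw [Multiset.coe_nodup]
    exact (I.nodup_word ν k).map e.injective
  · refine Multiset.Nodup.pairwise (fun k _ l _ hkl => ?_) S.nodup
    rw [Function.onFun, Multiset.coe_disjoint]
    intro j hj hj'
    obtain ⟨x, hx, rfl⟩ := List.mem_map.1 hj
    obtain ⟨y, hy, hxy⟩ := List.mem_map.1 hj'
    rw [e.injective hxy] at hy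
    exact hkl (I.eq_of_mem_word ν hx hy)

/-- The variables of the extended polynomial. -/
noncomputable def vars : Finset ℕ := ⟨_, I.nodup_bind_φ e⟩

theorem wordVars_substWords :
    ∀ z ∈ (substWords (I.φ e) f).coeff.support, wordVars z = (I.vars e).val := by
  intro z hz
  obtain ⟨y, hy, rfl⟩ := exists_of_mem_support_substWords hz
  rw [wordVars_lift, I.wordVars_eq y hy]
  rfl

theorem altSet_subset (r : Fin ν ⊕ Fin s) : I.altSet e r ⊆ I.vars e := by
  intro j hj
  have key : ∀ k ∈ S, ∀ x ∈ I.word ν k, e x ∈ I.vars e := by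
    intro k hk x hx
    refine Multiset.mem_bind.2 ⟨k, hk, ?_⟩
    rw [← coe_letters, letters_φ]
    exact List.mem_map_of_mem hx
  rw [mem_altSet] at hj
  rcases hj with ⟨c, rfl⟩ | ⟨i, rfl, rfl⟩
  · exact key _ (I.host_mem c) _ ((I.mem_word ν).2 (Or.inr ⟨_, _, _, rfl, rfl⟩))
  · exact key _ (I.w_mem i) _ ((I.mem_word ν).2 (Or.inl rfl))

/-- The evaluation of the extended polynomial. -/
noncomputable def evalVal : ℕ → A := Function.extend e (I.val ν) 0

theorem evalVal_apply (x : Var D s ν) : I.evalVal e (e x) = I.val ν x :=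
  e.injective.extend_apply _ _ _

theorem inr_lift_φ (g : ℕ → A) (k : ℕ) :
    ((FreeSemigroup.lift g (I.φ e k) : A) : Unitization F A)
      = ((I.word ν k).map fun x => (g (e x) : Unitization F A)).prod := by
  rw [inr_lift, letters_φ, List.map_map]
  rfl

theorem evalAt_substWords_evalVal : evalAt (I.evalVal e) (substWords (I.φ e) f) = evalAt I.a f := by
  rw [evalAt_substWords]
  congr 2
  funext k
  apply Unitization.inr_injective (R := F)
  rw [inr_lift_φ]
  simp only [evalVal_apply]
  exact I.prod_map_word_val ν k

variable [FiniteDimensional F A]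

/-- The outer variables of the triples are never permuted, so a triple whose middle value changed
either becomes 0 or has received the value of a radical variable that is not a host. In the second
case that radical variable has received a middle value, and `vanish` applies. -/
theorem evalAt_perm_eq_zero {l : List (Finset ℕ)} (hl : ∀ T, T ∈ l ↔ ∃ r, I.altSet e r = T)
    {π : Equiv.Perm ℕ} (hπ : Stabilizes l π) (hne : π ≠ 1) :
    evalAt (fun i => I.evalVal e (π i)) (substWords (I.φ e) f) = 0 := by
  rw [evalAt_substWords]
  have hmem : ∀ r j, π j ∈ I.altSet e r ↔ j ∈ I.altSet e r := fun r j => hπ.1 _ ((hl _).2 ⟨r, rfl⟩) j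
  have hfix : ∀ j, (∀ r, j ∉ I.altSet e r) → π j = j := fun j hj =>
    hπ.2 j fun T hT => by obtain ⟨r, rfl⟩ := (hl T).1 hT; exact hj r
  have hfix_new : ∀ r c i, i ≠ 1 → π (e (Sum.inr (r, c, i))) = e (Sum.inr (r, c, i)) := by
    intro r c i hi
    refine hfix _ fun r' h => ?_
    rw [mem_altSet] at h
    rcases h with ⟨c', h⟩ | ⟨i', -, h⟩ <;> have h := e.injective h
    · simp only [Sum.inr.injEq, Prod.mk.injEq] at h
      exact hi h.2.2.symm
    · cases h
  have hfix_old : ∀ k, (∀ i, I.w i ≠ k) → π (e (Sum.inl k)) = e (Sum.inl k) := by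
    intro k hk
    refine hfix _ fun r' h => ?_
    rw [mem_altSet] at h
    rcases h with ⟨c', h⟩ | ⟨i', -, h⟩ <;> have h := e.injective h
    · cases h
    · exact hk i' (Sum.inl.inj h)
  -- One vanishing triple kills the word substituted for its host, and the polynomial is linear in
  -- that host.
  by_cases htri : ∃ r c, I.u c * I.evalVal e (π (e (Sum.inr (r, c, 1)))) * I.v c = 0
  · obtain ⟨r, c, h⟩ := htri
    refine evalAt_eq_zero_of_zero I.wordVars_eq (I.host_mem c) ?_
    apply Unitization.inr_injective (R := F)
    rw [inr_lift_φ, Unitization.inr_zero]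
    refine I.prod_map_word_eq_zero ν (r := r) ?_
    simp only [hfix_new r c 0 (by decide), hfix_new r c 2 (by decide), evalVal_apply]
    simp only [val]
    rw [← Unitization.inr_mul, ← Unitization.inr_mul, h, Unitization.inr_zero]
  push Not at htri
  have hz : ∀ r c, π (e (Sum.inr (r, c, 1))) = e (Sum.inr (r, c, 1)) ∨
      ∃ i, r = Sum.inr i ∧ (∀ c, I.host c ≠ I.w i) ∧
        π (e (Sum.inr (r, c, 1))) = e (Sum.inl (I.w i)) := by
    intro r c
    have h1 := (hmem r (e (Sum.inr (r, c, 1)))).2 ((I.mem_altSet e).2 (Or.inl ⟨c, rfl⟩))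
    have h2 := htri r c
    rcases (I.mem_altSet e).1 h1 with ⟨c', h⟩ | ⟨i, hi, h⟩
    · left
      rw [← h, evalVal_apply] at h2
      by_cases hc : c = c'
      · rw [← h, hc]
      · exact absurd (I.mul_ne c c' hc) h2
    · refine Or.inr ⟨i, hi, fun c' hc' => ?_, h.symm⟩
      rw [← h, evalVal_apply] at h2
      exact h2 (I.mul_w i ⟨c', hc'⟩ c)
  have hw : ∀ i, π (e (Sum.inl (I.w i))) = e (Sum.inl (I.w i)) ∨
      ∃ c, π (e (Sum.inl (I.w i))) = e (Sum.inr (Sum.inr i, c, 1)) := by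
    intro i
    have h1 := (hmem (Sum.inr i) (e (Sum.inl (I.w i)))).2
      ((I.mem_altSet e).2 (Or.inr ⟨i, rfl, rfl⟩))
    rcases (I.mem_altSet e).1 h1 with ⟨c', h⟩ | ⟨i', hi, h⟩
    · exact Or.inr ⟨c', h.symm⟩
    · left
      rw [← h, Sum.inr.inj hi]
  -- Within one big set the radical variable can only move to a middle variable; if all of these are
  -- fixed, injectivity fixes it too.
  have hwfix : ∀ i, (∀ c, π (e (Sum.inr (Sum.inr i, c, 1))) = e (Sum.inr (Sum.inr i, c, 1))) →
      π (e (Sum.inl (I.w i))) = e (Sum.inl (I.w i)) := by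
    intro i hi
    rcases hw i with h | ⟨c, h⟩
    · exact h
    · rw [← hi c] at h
      have := e.injective (π.injective h)
      cases this
  have hwhost : ∀ i c, I.host c = I.w i → π (e (Sum.inl (I.w i))) = e (Sum.inl (I.w i)) := by
    intro i c hc
    refine hwfix i fun c' => ?_
    rcases hz (Sum.inr i) c' with h | ⟨i', hi', h, -⟩
    · exact h
    · obtain rfl := Sum.inr.inj hi'
      exact absurd hc (h c)
  have hnohost : ∀ k, (∀ c, I.host c ≠ k) →
      FreeSemigroup.lift (fun i => I.evalVal e (π i)) (I.φ e k)
        = I.evalVal e (π (e (Sum.inl k))) := by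
    intro k hk
    have hb : ∀ β, I.block ν k β = [] := fun β => List.eq_nil_iff_forall_not_mem.2 fun x hx => by
      obtain ⟨r, c, i, h, -⟩ := (I.mem_block ν).1 hx
      exact hk c h
    apply Unitization.inr_injective (R := F)
    rw [inr_lift_φ, word, hb, hb]
    simp
  refine I.vanish _ ?_ ?_ ?_ ?_
  · intro k _ hkw hkh
    rw [hnohost k hkh, hfix_old k hkw, evalVal_apply]
    rfl
  · rintro i ⟨c, hc⟩
    rw [mem_radical_iff, inr_lift_φ, word, List.map_append, List.prod_append, List.map_cons,
      List.prod_cons, hwhost i c hc, evalVal_apply]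
    exact Ideal.mul_mem_left _ _ (Ideal.mul_mem_right _ _ (mem_radical_iff.1 (I.w_radical i)))
  · intro i hi
    rw [hnohost _ hi]
    rcases hw i with h | ⟨c, h⟩
    · left
      rw [h, evalVal_apply]
      rfl
    · right
      rw [h, evalVal_apply]
      exact ⟨c, rfl⟩
  -- If no radical variable outside the hosts moved to a middle variable, all radical variables are
  -- fixed, hence all middle variables as well, and the permutation is trivial.
  · by_contra! hcon
    have hwall : ∀ i, π (e (Sum.inl (I.w i))) = e (Sum.inl (I.w i)) := by
      intro i
      by_cases hi : ∃ c, I.host c = I.w i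
      · obtain ⟨c, hc⟩ := hi
        exact hwhost i c hc
      · push Not at hi
        rcases hw i with h | ⟨c, h⟩
        · exact h
        · refine absurd ?_ (hcon i hi)
          rw [hnohost _ hi, h, evalVal_apply]
          exact ⟨c, rfl⟩
    apply hne
    ext j
    rw [Equiv.Perm.one_apply]
    by_cases hj : ∀ r, j ∉ I.altSet e r
    · exact hfix j hj
    · push Not at hj
      obtain ⟨r, hj⟩ := hj
      rcases (I.mem_altSet e).1 hj with ⟨c, rfl⟩ | ⟨i, rfl, rfl⟩
      · rcases hz r c with h | ⟨i, -, -, h⟩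
        · exact h
        · rw [← hwall i] at h
          have := e.injective (π.injective h)
          cases this
      · exact hwall i

theorem exists_isAlternatingFamily (I : Insertion (A := A) f S D s) (ν : ℕ) :
    ∃ g : NCPoly F, (∃ V : Finset ℕ, ∀ w ∈ g.coeff.support, wordVars w = V.val) ∧
      g ∉ identities F A ∧
      ∃ (small : Fin ν → Finset ℕ) (big : Fin s → Finset ℕ),
        IsAlternatingFamily g (Fintype.card D) small ∧
        IsAlternatingFamily g (Fintype.card D + 1) big ∧ ∀ i j, Disjoint (small i) (big j) := by
  classical
  obtain ⟨e, he⟩ := exists_injective_nat (Var D s ν)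
  lift e to Var D s ν ↪ ℕ using he
  let l : List (Finset ℕ) := (Finset.univ : Finset (Fin ν ⊕ Fin s)).toList.map (I.altSet e)
  have hl : ∀ T, T ∈ l ↔ ∃ r, I.altSet e r = T := by simp [l]
  have hpw : l.Pairwise Disjoint := by
    rw [List.pairwise_map]
    exact (Finset.nodup_toList _).imp fun h => I.disjoint_altSet e h
  have hsub : ∀ T ∈ l, T ⊆ I.vars e := by
    intro T hT
    obtain ⟨r, rfl⟩ := (hl T).1 hT
    exact I.altSet_subset e r
  have halt : ∀ r, IsAlternatingOn (altList l (substWords (I.φ e) f)) (I.altSet e r) := fun r =>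
    isAlternatingOn_altList hpw hsub (I.wordVars_substWords e) ((hl _).2 ⟨r, rfl⟩)
  refine ⟨altList l (substWords (I.φ e) f),
    ⟨I.vars e, wordVars_altList hsub (I.wordVars_substWords e)⟩, fun h => ?_,
    fun r => I.altSet e (Sum.inl r), fun r => I.altSet e (Sum.inr r),
    ⟨fun i j hij => I.disjoint_altSet e (by simpa using hij),
      fun i => ⟨I.card_altSet_inl e i, halt _⟩⟩,
    ⟨fun i j hij => I.disjoint_altSet e (by simpa using hij),
      fun i => ⟨I.card_altSet_inr e i, halt _⟩⟩,
    fun i j => I.disjoint_altSet e (by simp)⟩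
  have h1 := h (I.evalVal e)
  rw [evalAt_altList hpw fun π hπ hne => I.evalAt_perm_eq_zero e hl hπ hne,
    evalAt_substWords_evalVal] at h1
  exact I.evalAt_ne h1

end Insertion

/-! ### The bound on the number of big sets -/

section UpperBound

variable {F : Type u} [Field F] {A : Type v} [NonUnitalRing A] [Module F A]
  [IsScalarTower F A A] [SMulCommClass F A A]

/-- Pair each permutation with its product by the transposition of `i` and `j`: equal values,
opposite signs. -/
theorem IsAlternatingOn.evalAt_eq_zero {g : NCPoly F} {T : Finset ℕ} (hg : IsAlternatingOn g T)
    {b : ℕ → A} {i j : ℕ} (hi : i ∈ T) (hj : j ∈ T) (hij : i ≠ j) (hb : b i = b j) :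
    evalAt b g = 0 := by
  obtain ⟨-, h, -, hgh⟩ := hg
  have hgh : g = altOn T h := hgh
  rw [hgh, evalAt_altOn]
  let τ : Equiv.Perm T := Equiv.swap ⟨i, hi⟩ ⟨j, hj⟩
  have hne : (⟨i, hi⟩ : T) ≠ ⟨j, hj⟩ := fun h => hij (congrArg Subtype.val h)
  have hbτ : ∀ k, b (Equiv.Perm.ofSubtype τ k) = b k := by
    intro k
    rw [show Equiv.Perm.ofSubtype τ = Equiv.swap i j from Equiv.Perm.ofSubtype_swap_eq _ _]
    by_cases hki : k = i
    · rw [hki, Equiv.swap_apply_left, hb]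
    by_cases hkj : k = j
    · rw [hkj, Equiv.swap_apply_right, hb]
    rw [Equiv.swap_apply_of_ne_of_ne hki hkj]
  refine Finset.sum_involution (fun σ _ => τ * σ) ?_ ?_ (fun _ _ => Finset.mem_univ _) ?_
  · intro σ _
    have : (fun k => b (Equiv.Perm.ofSubtype (τ * σ) k))
        = fun k => b (Equiv.Perm.ofSubtype σ k) := by
      funext k
      rw [map_mul, Equiv.Perm.mul_apply, hbτ]
    rw [this, Equiv.Perm.sign_mul, Equiv.Perm.sign_swap hne]
    simp
  · intro σ _ _ hσ
    have : τ = 1 := by simpa using hσ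
    exact hne (Equiv.swap_eq_one_iff.1 this)
  · intro σ _
    rw [← mul_assoc, Equiv.swap_mul_self, one_mul]

/-- Evaluate on matrix units and radical elements. By the pigeonhole principle a set of d + 1
variables without a radical value repeats one of the d matrix units, so a nonzero value requires a
radical element in each of the disjoint sets. -/
theorem card_le_of_isAlternatingFamily [FiniteDimensional F A] (Z : Splitting F A) {g : NCPoly F}
    {V : Finset ℕ} (hV : ∀ w ∈ g.coeff.support, wordVars w = V.val) (hg : g ∉ identities F A)
    {m : ℕ} {X : Fin m → Finset ℕ} (hX : IsAlternatingFamily g (semisimpleDim F A + 1) X) :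
    m ≤ radicalIndex F A - 1 := by
  classical
  by_contra hm
  have hspan : Submodule.span F (Set.range Z.unit ∪ (radical F A : Set A)) = ⊤ := by
    rw [Submodule.span_union, Submodule.span_eq, ← Z.ss_sup_radical]
    congr 1
    congr 1
    ext x
    simp
  refine hg (evalAt_eq_zero_of_span hV hspan fun b hb => ?_)
  by_contra hne
  obtain ⟨w, hw⟩ : ∃ w, w ∈ g.coeff.support := by
    by_contra! h
    exact hne (evalAt_eq_zero_of_words fun w hw => absurd hw (h w))
  have hXV : ∀ i, X i ⊆ V := by
    intro i k hk
    have h1 := (hX.2 i).2.1 w hw k hk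
    rw [hV w hw] at h1
    exact Multiset.one_le_count_iff_mem.1 h1.ge
  have key : ∀ i, ∃ k ∈ X i, b k ∈ radical F A := by
    intro i
    by_contra! h
    have h1 : ∀ k : X i, ∃ c, Z.unit c = b k := fun k =>
      (hb k (hXV i k.2)).resolve_right (h k k.2)
    choose c hc using h1
    obtain ⟨k, k', hkk', hck⟩ := Fintype.exists_ne_map_eq_of_card_lt c (by
      rw [Z.card_pos, Fintype.card_coe, (hX.2 i).1]; omega)
    exact hne ((hX.2 i).2.evalAt_eq_zero k.2 k'.2 (fun h => hkk' (Subtype.ext h))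
      (by rw [← hc, ← hc, hck]))
  choose k hk hkr using key
  have hinj : Function.Injective k := by
    intro i j hij
    by_contra h
    exact Finset.disjoint_left.1 (hX.1 i j h) (hk i) (hij ▸ hk j)
  refine hne (evalAt_eq_zero_of_radicalIndex_le hV (W := Finset.univ.image k) ?_ ?_ ?_)
  · intro j hj
    obtain ⟨i, -, rfl⟩ := Finset.mem_image.1 hj
    exact hXV i (hk i)
  · intro j hj
    obtain ⟨i, -, rfl⟩ := Finset.mem_image.1 hj
    exact hkr i
  · rw [Finset.card_image_of_injective _ hinj, Finset.card_univ, Fintype.card_fin]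
    omega

end UpperBound

/-! ### Full evaluations and the choice of hosts -/

namespace Splitting

variable {F : Type u} [Field F] {A : Type v} [NonUnitalRing A] [Module F A]
  [IsScalarTower F A A] [SMulCommClass F A A] [FiniteDimensional F A] (Z : Splitting F A)

/-- The elements of the radical that lie in a single Peirce component. -/
def peirce : Set A := {x | x ∈ radical F A ∧
  ∃ p q, Z.E p p * (x : Unitization F A) * Z.E q q = x}

/-- Multiplying a radical element on both sides by 1 = Σ `E p p` splits it into Peirce components.
-/
theorem span_unit_union_peirce : Submodule.span F (Set.range Z.unit ∪ Z.peirce) = ⊤ := by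
  rw [eq_top_iff, ← Z.ss_sup_radical]
  refine sup_le (Submodule.span_le.2 ?_) fun x hx => ?_
  · rintro _ ⟨c, -, rfl⟩
    exact Submodule.subset_span (Or.inl ⟨c, rfl⟩)
  · have h1 : ∀ p q, ∃ y : A, (y : Unitization F A) = Z.E p p * x * Z.E q q := fun p q =>
      exists_inr_of_mem_jacobson
        (Ideal.mul_mem_right _ _ (Ideal.mul_mem_left _ _ (mem_radical_iff.1 hx)))
    choose y hy using h1
    have hxy : x = ∑ p, ∑ q, y p q := by
      apply Unitization.inr_injective (R := F)
      change _ = Unitization.inrNonUnitalAlgHom F A _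
      simp only [map_sum]
      change _ = ∑ p, ∑ q, (y p q : Unitization F A)
      simp only [hy, ← Finset.mul_sum, ← Finset.sum_mul, Z.isMatrixUnits.sum_eq_one, mul_one,
        one_mul]
    rw [hxy]
    refine Submodule.sum_mem _ fun p _ => Submodule.sum_mem _ fun q _ =>
      Submodule.subset_span (Or.inr ⟨?_, p, q, ?_⟩)
    · rw [mem_radical_iff, hy]
      exact Ideal.mul_mem_right _ _ (Ideal.mul_mem_left _ _ (mem_radical_iff.1 hx))
    · have hp := Z.isMatrixUnits.mul_same p p p rfl rfl
      have hq := Z.isMatrixUnits.mul_same q q q rfl rfl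
      rw [hy]
      calc _ = (Z.E p p * Z.E p p) * x * (Z.E q q * Z.E q q) := by noncomm_ring
        _ = _ := by rw [hp, hq]

/-- The data of a nonzero evaluation of a full polynomial in which every variable takes a value in
a Peirce component `E (p k) (p k) * A * E (q k) (q k)`. -/
structure FullEvaluation (f : NCPoly F) (S : Finset ℕ) where
  wordVars_eq : ∀ w ∈ f.coeff.support, wordVars w = S.val
  a : ℕ → A
  evalAt_ne : evalAt a f ≠ 0
  p : ℕ → Z.ι
  q : ℕ → Z.ι
  E_mul : ∀ k ∈ S, Z.E (p k) (p k) * (a k : Unitization F A) = a k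
  mul_E : ∀ k ∈ S, (a k : Unitization F A) * Z.E (q k) (q k) = a k
  w : Fin (radicalIndex F A - 1) → ℕ
  w_injective : Function.Injective w
  w_mem : ∀ i, w i ∈ S
  w_radical : ∀ i, a (w i) ∈ radical F A
  unit_of_ne : ∀ k ∈ S, (∀ i, w i ≠ k) → ∃ c : Z.Pos, a k = Z.unit c ∧ p k = c.1.1 ∧ q k = c.1.2
  full : ∀ c : Z.Pos, ∃ k ∈ S, Z.ty (p k) = Z.ty c.1.1 ∧ Z.ty (q k) = Z.ty c.1.1
  vanish : ∀ a' : ℕ → A, (∀ k ∈ S, (∀ i, w i ≠ k) → a' k = a k) →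
    (∀ i, a' (w i) ∈ radical F A ∨ a' (w i) ∈ Set.range Z.unit) →
    (∃ i, a' (w i) ∈ Set.range Z.unit) → evalAt a' f = 0

theorem exists_fullEvaluation [CharZero F] [Nontrivial A] (hA : IsBasic F A) :
    ∃ (f : NCPoly F) (S : Finset ℕ), Nonempty (Z.FullEvaluation f S) := by
  classical
  obtain ⟨f, ⟨S, hS⟩, hfA, hft, hfd⟩ := hA.exists_full_multilinear Z
  obtain ⟨a, ha, hne⟩ : ∃ a : ℕ → A, (∀ k ∈ S, a k ∈ Set.range Z.unit ∪ Z.peirce) ∧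
      evalAt a f ≠ 0 := by
    by_contra! h
    exact hfA (evalAt_eq_zero_of_span hS Z.span_unit_union_peirce h)
  have h1 : ∀ k, ∃ p q, k ∈ S → Z.E p p * (a k : Unitization F A) = a k ∧
      (a k : Unitization F A) * Z.E q q = a k ∧
      (a k ∉ radical F A → ∃ c : Z.Pos, a k = Z.unit c ∧ p = c.1.1 ∧ q = c.1.2) := by
    intro k
    by_cases hk : k ∈ S
    · rcases ha k hk with ⟨c, hc⟩ | ⟨hr, p, q, hpq⟩
      · refine ⟨c.1.1, c.1.2, fun _ => ⟨?_, ?_, fun _ => ⟨c, hc.symm, rfl, rfl⟩⟩⟩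
        · rw [← hc, inr_unit, Z.isMatrixUnits.mul_same _ _ _ rfl c.2.1]
        · rw [← hc, inr_unit, Z.isMatrixUnits.mul_same _ _ _ c.2.1 rfl]
      · refine ⟨p, q, fun _ => ⟨?_, ?_, fun h => absurd hr h⟩⟩
        · rw [← hpq, ← mul_assoc, ← mul_assoc, Z.isMatrixUnits.mul_same _ _ _ rfl rfl]
        · rw [← hpq, mul_assoc, Z.isMatrixUnits.mul_same _ _ _ rfl rfl]
    · exact ⟨Z.base, Z.base, fun h => absurd h hk⟩
  choose p q hpq using h1
  let W := S.filter fun k => a k ∈ radical F A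
  have hss : ∀ k ∈ S, k ∉ W → a k ∈ Z.ss := by
    intro k hk hkW
    obtain ⟨c, hc, -⟩ := (hpq k hk).2.2 fun h => hkW (Finset.mem_filter.2 ⟨hk, h⟩)
    rw [hc]
    exact Z.unit_mem_ss c
  have hindex := (one_le_radicalIndex_and_radicalPow F A).1
  -- More radical values would vanish by nilpotency, fewer by the identity of the truncated algebra.
  have hW : W.card = radicalIndex F A - 1 := by
    apply le_antisymm
    · by_contra h
      have hlt : radicalIndex F A ≤ W.card := by omega
      exact hne (evalAt_eq_zero_of_radicalIndex_le hS (Finset.filter_subset _ _)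
        (fun k hk => (Finset.mem_filter.1 hk).2) hlt)
    · by_contra h
      refine hne (Z.evalAt_eq_zero_of_mem_identities_trunc hS hft (fun k hk => ?_)
        (lt_of_le_of_lt (Finset.card_le_card ?_) (not_le.1 h)))
      · by_cases hkW : k ∈ W
        · exact Or.inr (Finset.mem_filter.1 hkW).2
        · exact Or.inl (hss k hk hkW)
      · intro k hk
        by_contra hkW
        exact (Finset.mem_filter.1 hk).2 (hss k (Finset.mem_filter.1 hk).1 hkW)
  let w := W.equivFinOfCardEq hW
  have hwW : ∀ k, k ∈ W ↔ ∃ i, (w.symm i : ℕ) = k := by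
    intro k
    constructor
    · exact fun hk => ⟨w ⟨k, hk⟩, by simp⟩
    · rintro ⟨i, rfl⟩
      exact (w.symm i).2
  refine ⟨f, S, ⟨⟨hS, a, hne, p, q, fun k hk => (hpq k hk).1, fun k hk => (hpq k hk).2.1,
    fun i => w.symm i, ?_, ?_, ?_, ?_, ?_, ?_⟩⟩⟩
  · exact Subtype.val_injective.comp w.symm.injective
  · exact fun i => (Finset.mem_filter.1 (w.symm i).2).1
  · exact fun i => (Finset.mem_filter.1 (w.symm i).2).2
  · intro k hk hkw
    refine (hpq k hk).2.2 fun h => ?_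
    obtain ⟨i, hi⟩ := (hwW k).1 (Finset.mem_filter.2 ⟨hk, h⟩)
    exact hkw i hi
  · intro c
    by_contra! h
    -- If no variable stays inside the block of `c`, all values lie in the subalgebra without that
    -- block.
    refine hne (Z.evalAt_eq_zero_of_mem_identities_deleteBlock hS (hfd c.1.1 c.2.2) fun k hk => ?_)
    by_cases hr : a k ∈ radical F A
    · exact Z.radical_le_deleteBlock hr
    · obtain ⟨c', hc', hp, hq⟩ := (hpq k hk).2.2 hr
      rw [hc']
      refine Z.unit_mem_deleteBlock fun hty => h k hk (by rw [hp, hty]) ?_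
      rw [hq, ← c'.2.1, hty]
  · intro a' h1 h2 ⟨i0, h3⟩
    have h4 : ∀ k ∈ S, k ∉ W → a' k ∈ Z.ss := by
      intro k hk hkW
      rw [h1 k hk fun i hi => hkW ((hwW k).2 ⟨i, hi⟩)]
      exact hss k hk hkW
    have h5 : ∀ x ∈ Set.range Z.unit, x ∈ Z.ss := by
      rintro _ ⟨c, rfl⟩
      exact Z.unit_mem_ss c
    refine Z.evalAt_eq_zero_of_mem_identities_trunc hS hft (fun k hk => ?_) ?_
    · by_cases hkW : k ∈ W
      · obtain ⟨i, rfl⟩ := (hwW k).1 hkW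
        exact (h2 i).symm.imp (h5 _) id
      · exact Or.inl (h4 k hk hkW)
    -- A matrix unit in one of the radical positions leaves fewer than n_A - 1 values outside the
    -- semisimple part.
    · rw [← hW]
      refine Finset.card_lt_card ⟨fun k hk => ?_, fun hsub => ?_⟩
      · by_contra hkW
        exact (Finset.mem_filter.1 hk).2 (h4 k (Finset.mem_filter.1 hk).1 hkW)
      · exact (Finset.mem_filter.1 (hsub (w.symm i0).2)).2 (h5 _ h3)

/-- The values `u c`, `b c`, `v c` of an inserted word, with value `E P P`. -/
theorem e_mul_unit_mul_e {P : Z.ι} (c : Z.Pos) (hP : Z.ty P = Z.ty c.1.1) (hb : P ≠ Z.base) :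
    ((Z.e P c.1.1 * Z.unit c * Z.e c.1.2 P : A) : Unitization F A) = Z.E P P := by
  rw [Unitization.inr_mul, Unitization.inr_mul, Z.inr_e hb, Z.inr_e (Pos.snd_ne Z c), inr_unit,
    Z.isMatrixUnits.mul_same _ _ _ hP c.2.1,
    Z.isMatrixUnits.mul_same _ _ _ (hP.trans c.2.1) (hP.trans c.2.1).symm]

theorem e_mul_unit_mul_e_of_ne {P : Z.ι} {c c' : Z.Pos} (hb : P ≠ Z.base) (h : c ≠ c') :
    Z.e P c.1.1 * Z.unit c' * Z.e c.1.2 P = 0 := by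
  apply Unitization.inr_injective (R := F)
  rw [Unitization.inr_mul, Unitization.inr_mul, Z.inr_e hb, Z.inr_e (Pos.snd_ne Z c), inr_unit,
    Unitization.inr_zero]
  by_cases h1 : c.1.1 = c'.1.1
  · have h2 : c'.1.2 ≠ c.1.2 := fun h2 => h (Subtype.ext (Prod.ext h1 h2.symm))
    rw [mul_assoc, Z.isMatrixUnits.mul_of_ne _ _ _ _ h2, mul_zero]
  · rw [Z.isMatrixUnits.mul_of_ne _ _ _ _ h1, zero_mul]

namespace FullEvaluation

variable {Z} {f : NCPoly F} {S : Finset ℕ} (I : Z.FullEvaluation f S)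

/-- Both ends of `c` lie in one block, while the value connects two different ones, so it fails to
match on at least one side. -/
theorem e_mul_a_mul_e_eq_zero {k : ℕ} (hk : k ∈ S) (hpq : Z.ty (I.p k) ≠ Z.ty (I.q k)) {P : Z.ι}
    (hb : P ≠ Z.base) (c : Z.Pos) : Z.e P c.1.1 * I.a k * Z.e c.1.2 P = 0 := by
  apply Unitization.inr_injective (R := F)
  rw [Unitization.inr_mul, Unitization.inr_mul, Z.inr_e hb, Z.inr_e (Pos.snd_ne Z c),
    Unitization.inr_zero]
  by_cases h1 : c.1.1 = I.p k
  · have h2 : I.q k ≠ c.1.2 := fun h2 => hpq (by rw [← h1, h2, c.2.1])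
    rw [← I.mul_E k hk, mul_assoc, mul_assoc, Z.isMatrixUnits.mul_of_ne _ _ _ _ h2, mul_zero,
      mul_zero]
  · rw [← I.E_mul k hk, ← mul_assoc, Z.isMatrixUnits.mul_of_ne _ _ _ _ h1, zero_mul, zero_mul]

/-- Insertion next to radical variables that connect different blocks. -/
theorem nonempty_insertion_of_mixed (h : ∀ c : Z.Pos, ∃ i, Z.ty (I.p (I.w i)) ≠ Z.ty (I.q (I.w i)) ∧
      (Z.ty (I.p (I.w i)) = Z.ty c.1.1 ∨ Z.ty (I.q (I.w i)) = Z.ty c.1.1)) :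
    Nonempty (Insertion (A := A) f S Z.Pos (radicalIndex F A - 1)) := by
  classical
  choose i hi hi' using h
  -- The end of the host value that lies in the block of `c`; the word is inserted on that side.
  let P : Z.Pos → Z.ι := fun c =>
    if Z.ty (I.p (I.w (i c))) = Z.ty c.1.1 then I.p (I.w (i c)) else I.q (I.w (i c))
  have hP : ∀ c, Z.ty (P c) = Z.ty c.1.1 := by
    intro c
    simp only [P]
    split_ifs with h
    · exact h
    · exact (hi' c).resolve_left h
  have hb : ∀ c, P c ≠ Z.base := fun c h => c.2.2 (Z.eq_base _ (by rw [← hP, h]))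
  refine ⟨{
    wordVars_eq := I.wordVars_eq
    a := I.a
    evalAt_ne := I.evalAt_ne
    b := Z.unit
    u := fun c => Z.e (P c) c.1.1
    v := fun c => Z.e c.1.2 (P c)
    host := fun c => I.w (i c)
    left := fun c => decide (Z.ty (I.p (I.w (i c))) = Z.ty c.1.1)
    w := I.w
    host_mem := fun c => I.w_mem _
    w_mem := I.w_mem
    w_injective := I.w_injective
    w_radical := I.w_radical
    mul_left := fun c hc => ?_
    mul_right := fun c hc => ?_
    mul_ne := fun c c' hc => Z.e_mul_unit_mul_e_of_ne (hb c) hc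
    mul_w := ?_
    vanish := ?_ }⟩
  · apply Unitization.inr_injective (R := F)
    rw [Unitization.inr_mul, Z.e_mul_unit_mul_e c (hP c) (hb c)]
    simp only [P, if_pos (of_decide_eq_true hc)]
    exact I.E_mul _ (I.w_mem _)
  · apply Unitization.inr_injective (R := F)
    rw [Unitization.inr_mul, Z.e_mul_unit_mul_e c (hP c) (hb c)]
    simp only [P, if_neg (of_decide_eq_false hc)]
    exact I.mul_E _ (I.w_mem _)
  · rintro j ⟨c', hc'⟩ c
    refine I.e_mul_a_mul_e_eq_zero (I.w_mem j) ?_ (hb c) c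
    rw [← hc']
    exact hi c'
  · intro a' h1 h2 h3 ⟨j, hj, hj'⟩
    refine I.vanish a' (fun k hk hkw => h1 k hk hkw fun c => hkw _) (fun j => ?_) ⟨j, hj'⟩
    by_cases hjh : ∃ c, I.w (i c) = I.w j
    · exact Or.inl (h2 j hjh)
    · push Not at hjh
      rcases h3 j hjh with h | h
      · left
        rw [h]
        exact I.w_radical j
      · exact Or.inr h

/-- In a nonzero product, the right Peirce index of each factor is the left index of the next. If no
factor enters or leaves block `t`, the product is entirely inside or entirely outside it. -/
theorem ty_p_iff_of_prod_ne_zero {t : ℕ}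
    (ht : ∀ k ∈ S, (Z.ty (I.p k) = t ↔ Z.ty (I.q k) = t)) {k0 : ℕ} {l : List ℕ}
    (hl : ∀ k ∈ k0 :: l, k ∈ S)
    (h : ((k0 :: l).map fun k => (I.a k : Unitization F A)).prod ≠ 0) :
    ∀ k ∈ k0 :: l, (Z.ty (I.p k) = t ↔ Z.ty (I.p k0) = t) := by
  induction l generalizing k0 with
  | nil => simp
  | cons k1 l ih =>
    have hk0 : k0 ∈ S := hl k0 (by simp)
    have hk1 : k1 ∈ S := hl k1 (by simp)
    rw [List.map_cons, List.prod_cons] at h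
    have h1 := ih (fun k hk => hl k (List.mem_cons_of_mem _ hk)) (right_ne_zero_of_mul h)
    have h2 : I.q k0 = I.p k1 := by
      by_contra hne
      apply h
      rw [List.map_cons, List.prod_cons, ← mul_assoc, ← I.mul_E k0 hk0, ← I.E_mul k1 hk1, mul_assoc
        (I.a k0 : Unitization F A), ← mul_assoc (Z.E _ _), Z.isMatrixUnits.mul_of_ne _ _ _ _ hne,
        zero_mul, mul_zero, zero_mul]
    intro k hk
    rcases List.mem_cons.1 hk with rfl | hk
    · rfl
    · rw [h1 k hk, ht k0 hk0, h2]

/-- If some block is not adjacent to a connecting radical variable, then it is the only block. -/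
theorem ty_eq_of_not_mixed {c0 : Z.Pos} (h : ∀ i, Z.ty (I.p (I.w i)) ≠ Z.ty (I.q (I.w i)) →
      Z.ty (I.p (I.w i)) ≠ Z.ty c0.1.1 ∧ Z.ty (I.q (I.w i)) ≠ Z.ty c0.1.1) :
    ∀ k ∈ S, Z.ty (I.p k) = Z.ty c0.1.1 ∧ Z.ty (I.q k) = Z.ty c0.1.1 := by
  have hiff : ∀ k ∈ S, (Z.ty (I.p k) = Z.ty c0.1.1 ↔ Z.ty (I.q k) = Z.ty c0.1.1) := by
    intro k hk
    by_cases hkw : ∃ i, I.w i = k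
    · obtain ⟨i, rfl⟩ := hkw
      by_cases hm : Z.ty (I.p (I.w i)) = Z.ty (I.q (I.w i))
      · rw [hm]
      · exact iff_of_false (h i hm).1 (h i hm).2
    · push Not at hkw
      obtain ⟨c, -, hp, hq⟩ := I.unit_of_ne k hk hkw
      rw [hp, hq, c.2.1]
  obtain ⟨z, hz, hz0⟩ : ∃ z ∈ f.coeff.support, FreeSemigroup.lift I.a z ≠ 0 := by
    by_contra! h0
    exact I.evalAt_ne (evalAt_eq_zero_of_words h0)
  have hmem : ∀ k, k ∈ letters z ↔ k ∈ S := fun k => by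
    rw [← Multiset.mem_coe, coe_letters, I.wordVars_eq z hz, Finset.mem_val]
  have hprod : ((letters z).map fun k => (I.a k : Unitization F A)).prod ≠ 0 := by
    rw [← inr_lift]
    intro h0
    exact hz0 (Unitization.inr_injective (R := F) (by rw [h0, Unitization.inr_zero]))
  have hall := I.ty_p_iff_of_prod_ne_zero hiff (fun k hk => (hmem k).1 hk) hprod
  obtain ⟨k1, hk1, hk1p, -⟩ := I.full c0
  have hhead := (hall k1 ((hmem k1).2 hk1)).1 hk1p
  intro k hk
  have hkp := (hall k ((hmem k).2 hk)).2 hhead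
  exact ⟨hkp, (hiff k hk).1 hkp⟩

/-- Insertion after the last variable, for an algebra with one block. -/
theorem nonempty_insertion_of_not_mixed {c0 : Z.Pos}
    (h : ∀ k ∈ S, Z.ty (I.p k) = Z.ty c0.1.1 ∧ Z.ty (I.q k) = Z.ty c0.1.1) :
    ∃ (g : NCPoly F) (V : Finset ℕ),
      Nonempty (Insertion (A := A) g V Z.Pos (radicalIndex F A - 1)) := by
  classical
  have hty : ∀ c : Z.Pos, Z.ty c.1.1 = Z.ty c0.1.1 := by
    intro c
    obtain ⟨k, hk, hkp, -⟩ := I.full c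
    rw [← hkp, (h k hk).1]
  -- Decompose the nonzero value by 1 = Σ `E P P` on the right. Every monomial ends in the only
  -- block, so `P` belongs to it and is not the base.
  obtain ⟨P, hP⟩ : ∃ P, (evalAt I.a f : Unitization F A) * Z.E P P ≠ 0 := by
    by_contra! h0
    apply I.evalAt_ne
    apply Unitization.inr_injective (R := F)
    rw [← mul_one ((evalAt I.a f : A) : Unitization F A), ← Z.isMatrixUnits.sum_eq_one,
      Finset.mul_sum, Unitization.inr_zero]
    exact Finset.sum_eq_zero fun P _ => h0 P
  have hPty : Z.ty P = Z.ty c0.1.1 := by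
    by_contra hne
    apply hP
    rw [inr_evalAt, Finset.sum_mul]
    refine Finset.sum_eq_zero fun z hz => ?_
    have hk : (letters z).getLast (by simp [letters]) ∈ S := by
      rw [← Finset.mem_val, ← I.wordVars_eq z hz, ← coe_letters, Multiset.mem_coe]
      exact List.getLast_mem _
    have hq : I.q ((letters z).getLast (by simp [letters])) ≠ P := by
      rintro rfl
      exact hne (h _ hk).2
    rw [smul_mul_assoc, ← List.dropLast_append_getLast (l := letters z) (by simp [letters]),
      List.map_append, List.prod_append, List.map_singleton, List.prod_singleton, ← I.mul_E _ hk,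
      mul_assoc, mul_assoc, Z.isMatrixUnits.mul_of_ne _ _ _ _ hq, mul_zero, mul_zero, smul_zero]
  have hb : P ≠ Z.base := fun h1 => c0.2.2 (Z.eq_base _ (by rw [← hPty, h1]))
  -- A fresh last variable with value `e P P` hosts all the words, so no radical variable is a host.
  obtain ⟨N, hN⟩ := Infinite.exists_notMem_finset S
  let x : NCPoly F := MonoidAlgebra.single (FreeSemigroup.of N) 1
  have hx : ∀ b : ℕ → A, evalAt b (f * x) = evalAt b f * b N := by
    intro b
    rw [map_mul, evalAt_single, FreeSemigroup.lift_of, one_smul]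
  have hcongr : ∀ b b' : ℕ → A, (∀ k ∈ S, b k = b' k) → evalAt b f = evalAt b' f :=
    fun b b' hbb' => evalAt_congr fun z hz k hk => hbb' k (by rwa [I.wordVars_eq z hz] at hk)
  have hupd : ∀ k ∈ S, Function.update I.a N (Z.e P P) k = I.a k := fun k hk =>
    Function.update_of_ne (by rintro rfl; exact hN hk) _ _
  have hwN : ∀ i, I.w i ≠ N := fun i hi => hN (hi ▸ I.w_mem i)
  refine ⟨f * x, insert N S, ⟨{
    wordVars_eq := ?_
    a := Function.update I.a N (Z.e P P)
    evalAt_ne := ?_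
    b := Z.unit
    u := fun c => Z.e P c.1.1
    v := fun c => Z.e c.1.2 P
    host := fun c => N
    left := fun c => true
    w := I.w
    host_mem := fun c => Finset.mem_insert_self _ _
    w_mem := fun i => Finset.mem_insert_of_mem (I.w_mem i)
    w_injective := I.w_injective
    w_radical := fun i => by rw [hupd _ (I.w_mem i)]; exact I.w_radical i
    mul_left := fun c _ => ?_
    mul_right := fun c hc => by cases hc
    mul_ne := fun c c' hc => Z.e_mul_unit_mul_e_of_ne hb hc
    mul_w := fun i ⟨c, hc⟩ => absurd hc.symm (hwN i)
    vanish := ?_ }⟩⟩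
  · intro z hz
    classical
    obtain ⟨y, hy, rfl⟩ := Finset.mem_image.1
      (MonoidAlgebra.support_coeff_mul_single_subset f 1 (FreeSemigroup.of N) hz)
    rw [wordVars_mul, I.wordVars_eq y hy, Finset.insert_val_of_notMem hN, add_comm]
    rfl
  · rw [hx, hcongr _ _ hupd, Function.update_self]
    intro h0
    apply hP
    rw [← Z.inr_e hb, ← Unitization.inr_mul, h0, Unitization.inr_zero]
  · apply Unitization.inr_injective (R := F)
    rw [Unitization.inr_mul, Z.e_mul_unit_mul_e c (hPty.trans (hty c).symm) hb,
      Function.update_self, Z.inr_e hb, Z.isMatrixUnits.mul_same _ _ _ rfl rfl]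
  · intro a' h1 h2 h3 ⟨j, hj, hj'⟩
    rw [hx, I.vanish a' ?_ ?_ ⟨j, hj'⟩, zero_mul]
    · intro k hk hkw
      rw [h1 k (Finset.mem_insert_of_mem hk) hkw fun c hc => hN (hc ▸ hk), hupd k hk]
    · intro i
      rcases h3 i fun c hc => hwN i hc.symm with h4 | h4
      · left
        rw [h4, hupd _ (I.w_mem i)]
        exact I.w_radical i
      · exact Or.inr h4

theorem exists_insertion (I : Z.FullEvaluation f S) : ∃ (g : NCPoly F) (V : Finset ℕ),
    Nonempty (Insertion (A := A) g V Z.Pos (radicalIndex F A - 1)) := by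
  by_cases h : ∀ c : Z.Pos, ∃ i, Z.ty (I.p (I.w i)) ≠ Z.ty (I.q (I.w i)) ∧
      (Z.ty (I.p (I.w i)) = Z.ty c.1.1 ∨ Z.ty (I.q (I.w i)) = Z.ty c.1.1)
  · exact ⟨f, S, I.nonempty_insertion_of_mixed h⟩
  · push Not at h
    obtain ⟨c0, h0⟩ := h
    exact I.nonempty_insertion_of_not_mixed (I.ty_eq_of_not_mixed h0)

end FullEvaluation

end Splitting

end PIAlgebra

theorem mainTheorem6 (F : Type u) [Field F] [CharZero F] [IsAlgClosed F]
    (A : Type v) [NonUnitalRing A] [Module F A] [IsScalarTower F A A] [SMulCommClass F A A]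
    [FiniteDimensional F A] [Nontrivial A] (hA : PIAlgebra.IsBasic F A) (ν : ℕ) :
    ∃ f : PIAlgebra.NCPoly F,
      PIAlgebra.IsMultilinear f ∧
      f ∉ PIAlgebra.identities F A ∧
      (∃ (small : Fin ν → Finset ℕ) (big : Fin (PIAlgebra.radicalIndex F A - 1) → Finset ℕ),
        PIAlgebra.IsAlternatingFamily f (PIAlgebra.semisimpleDim F A) small ∧
        PIAlgebra.IsAlternatingFamily f (PIAlgebra.semisimpleDim F A + 1) big ∧
        ∀ i j, Disjoint (small i) (big j)) ∧
      (∀ (m : ℕ) (X : Fin m → Finset ℕ),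
        PIAlgebra.IsAlternatingFamily f (PIAlgebra.semisimpleDim F A + 1) X →
          m ≤ PIAlgebra.radicalIndex F A - 1) := by
  obtain ⟨Z⟩ := PIAlgebra.nonempty_splitting F A
  obtain ⟨f, S, ⟨I⟩⟩ := Z.exists_fullEvaluation hA
  obtain ⟨g, V, ⟨J⟩⟩ := I.exists_insertion
  obtain ⟨f, ⟨V, hV⟩, hf, small, big, hsmall, hbig, hdisj⟩ := J.exists_isAlternatingFamily ν
  rw [Z.card_pos] at hsmall hbig
  exact ⟨f, ⟨V, hV⟩, hf, ⟨small, big, hsmall, hbig, hdisj⟩,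
    fun m X hX => PIAlgebra.card_le_of_isAlternatingFamily Z hV hf hX⟩
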